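/- Let $C$ be a compact Hausdorff space, $\sigma:C\to C$ a surjective local homeomorphism, $\alpha(f)=f\circ\sigma$ on $A:=C(C)$, and $L(f)(c)=|\sigma^{-1}(c)|^{-1}\sum_{\sigma(d)=c}f(d)$ the normalized transfer operator. For a Hilbert $A$-module $X$ and $k\ge 0$, let $X_{L^k}$ be the Hilbert $A$-module with underlying space $X$, module action $x\cdot\alpha^k(f)$ and inner product $L^k(\langle x,y\rangle)$; write $X_L=X_{L^1}$. Let $M_L=(A_A)_L$ be Exel's correspondence, with left action by multiplication. All tensor products are internal, $X\otimes_A M_L$ is identified with $X_L$ via $x\otimes f\mapsto x\cdot f$, and the direct limit of a sequence of Hilbert modules and inner-product preserving module maps is the completion of its algebraic direct limit. Given closed submodules $V_k$ $(k\ge 0)$ of a closed submodule $W$ of a Hilbert module $X$ and a linear bijection $D:X\to X$, we say that $\{V_k\}$ is a projective multi-resolution analysis for $W$ if (i) $V_0$ is a complemented submodule of $W$; (ii) $V_k=D^{-k}(V_0)$ for $k\ge 0$; (iii) $V_k$ is a complemented submodule of $V_{k+1}$ for $k\ge 0$; (iv) $\bigcup_k V_k$ is dense in $W$. (1) Let $Y$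 be a Hilbert $A$-module and let $T:Y\to Y_L$ be adjointable and inner-product preserving. Then for every $k\ge 0$, $T$ is also adjointable and inner-product preserving as a map $Y_{L^k}\to Y_{L^{k+1}}$. Let $(Y_\infty,\iota^k)=\varinjlim(Y_{L^k},T)$. There is a Hilbert-module isomorphism $R$ of $Y_\infty$ onto $Y_\infty\otimes_A M_L=(Y_\infty)_L$ such that $R\circ\iota^{k+1}=\iota^k\otimes\mathrm{id}$ for $k\ge 0$ (where $Y_{L^{k+1}}=(Y_{L^k})_L=Y_{L^k}\otimes_A M_L$), with the following property. Suppose that $X$ is a Hilbert $A$-module, that $D:X\to X$ is a linear bijection with $$D(x\cdot f)=(Dx)\cdot\alpha(f)\quad\text{and}\quad L(\langle Dx,Dy\rangle)=\langle x,y\rangle ,$$ and that $Q_0:Y\to X$ is inner-product preserving with $D\circ Q_0=Q_0\circ T$. Then there is an inner-product preserving map $Q:Y_\infty\to X$ such that $Q\circ\iota^0=Q_0$ and $D\circ Q=Q\circ R$, and the submodules $V_k:=Q(\iota^k(Y_{L^k}))$ form a projective multi-resolution analysis for $Q(Y_\infty)$. (2) Let $m\in M_L$ be a filter, that is, $\langle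 m,m\rangle=1$ in $M_L$. Let $M_\infty=\varinjlim(M_L^{\otimes k},T_k)$, where $M_L^{\otimes 0}=A$, $T_0a=m\cdot a$, and $T_kn=m\otimes n$ for $k\ge 1$. There is a Hilbert-module isomorphism $R$ of $M_\infty$ onto $M_\infty\otimes_A M_L=(M_\infty)_L$ such that $R\circ\iota^{k+1}=\iota^k\otimes\mathrm{id}$ for $k\ge 0$ (where $A\otimes_A M_L=M_L$), with the following property. Suppose that $X$ is a Hilbert $A$-module, $\phi\in X$ satisfies $\langle\phi,\phi\rangle=1$, and $D:X\to X$ is a linear bijection with $$D(x\cdot f)=(Dx)\cdot\alpha(f),\quad L(\langle Dx,Dy\rangle)=\langle x,y\rangle\quad\text{and}\quad D\phi=\phi\cdot m .$$ Then $(X,D,\phi)$ is a scaling function for $m$: regarded as a map $X\to X_L=X\otimes_A M_L$, $D$ is a Hilbert-module isomorphism with $D\phi=\phi\otimes m$. Moreover there is an inner-product preserving module map $Q:M_\infty\to X$ such that $(Q\circ\iota^0)(1)=\phi$ and $D\circ Q=Q\circ R$, and the submodules $V_k:=Q(\iota^k(M_L^{\otimes k}))=D^{-k}(V_0)$ form a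 projective multi-resolution analysis for $Q(M_\infty)$. -/

import Mathlib

open scoped ComplexOrder TensorProduct

universe u v w

noncomputable section

/-- A surjective local homeomorphism `σ` of the space `C`. -/
structure ExelSystem (C : Type w) [TopologicalSpace C] where
  /-- the map `σ` -/
  map : C → C
  isLocalHomeomorph : IsLocalHomeomorph map
  surjective : Function.Surjective map

namespace ExelSystem

variable {C : Type w} [TopologicalSpace C] [CompactSpace C] [T2Space C] (S : ExelSystem C)

theorem continuous_map : Continuous S.map := S.isLocalHomeomorph.continuous

/-- The endomorphism `α : f ↦ f ∘ σ` of `C(C)`. -/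
def endo : C(C, ℂ) →⋆ₐ[ℂ] C(C, ℂ) :=
  ContinuousMap.compStarAlgHom' ℂ ℂ ⟨S.map, S.continuous_map⟩

theorem endo_apply (f : C(C, ℂ)) (c : C) : S.endo f c = f (S.map c) := rfl

theorem finite_fiber (c : C) : (S.map ⁻¹' {c}).Finite := by
  refine (isClosed_singleton.preimage S.continuous_map).isCompact.finite ?_
  have h := (isLocalHomeomorph_iff_isCoveringMap.mp S.isLocalHomeomorph c).discreteTopology_fiber
  exact isDiscrete_iff_discreteTopology.mpr h

/-- The finite set `σ⁻¹(c)`. -/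
def fiber (c : C) : Finset C := (S.finite_fiber c).toFinset

theorem mem_fiber {c d : C} : d ∈ S.fiber c ↔ S.map d = c := by simp [fiber]

theorem card_fiber_pos (c : C) : 0 < (S.fiber c).card := by
  obtain ⟨d, hd⟩ := S.surjective c
  exact Finset.card_pos.mpr ⟨d, S.mem_fiber.mpr hd⟩

/-- Locally, sums over the fibres are sums over finitely many continuous sections of `σ`. -/
theorem exists_local_sections (c : C) : ∃ (U : Set C) (n : ℕ) (s : Fin n → U → C),
    IsOpen U ∧ c ∈ U ∧ (∀ i, Continuous (s i)) ∧
    (∀ x : U, Function.Injective fun i => s i x) ∧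
    ∀ (x : U) (d : C), S.map d = x ↔ ∃ i, s i x = d := by
  obtain ⟨hI, U, hcU, hU, -, H, hH⟩ :=
    isLocalHomeomorph_iff_isCoveringMap.mp S.isLocalHomeomorph c
  have : Finite (S.map ⁻¹' {c}) := S.finite_fiber c
  obtain ⟨n, ⟨e⟩⟩ := Finite.exists_equiv_fin (S.map ⁻¹' {c})
  refine ⟨U, n, fun i x => (H.symm (x, e.symm i)).1, hU, hcU, fun i => ?_, fun x i j hij => ?_,
    fun x d => ⟨fun hd => ?_, ?_⟩⟩
  · fun_prop
  · have := H.symm.injective (Subtype.ext hij)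
    simpa using this
  · have hdU : d ∈ S.map ⁻¹' U := by simp [hd]
    refine ⟨e (H ⟨d, hdU⟩).2, ?_⟩
    have : (x, (H ⟨d, hdU⟩).2) = H ⟨d, hdU⟩ := by
      refine Prod.ext (Subtype.ext ?_) rfl
      simp [hH, hd]
    simp [this]
  · rintro ⟨i, rfl⟩
    have := hH (H.symm (x, e.symm i))
    simpa using this.symm

theorem sum_fiber_eq {c : C} {n : ℕ} (s : Fin n → C) (hs : Function.Injective s)
    (h : ∀ d, S.map d = c ↔ ∃ i, s i = d) (f : C → ℂ) :
    ∑ d ∈ S.fiber c, f d = ∑ i, f (s i) := by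
  classical
  have : S.fiber c = Finset.univ.image s := by
    ext d; simp [mem_fiber, h]
  rw [this, Finset.sum_image (fun i _ j _ hij => hs hij)]

theorem card_fiber_eq {c : C} {n : ℕ} (s : Fin n → C) (hs : Function.Injective s)
    (h : ∀ d, S.map d = c ↔ ∃ i, s i = d) : (S.fiber c).card = n := by
  classical
  have : S.fiber c = Finset.univ.image s := by
    ext d; simp [mem_fiber, h]
  rw [this, Finset.card_image_of_injective _ hs, Finset.card_univ, Fintype.card_fin]

theorem continuous_transfer (f : C(C, ℂ)) :
    Continuous fun c => ((S.fiber c).card : ℂ)⁻¹ * ∑ d ∈ S.fiber c, f d := by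
  rw [continuous_iff_continuousAt]
  intro c
  obtain ⟨U, n, s, hU, hc, hs, hinj, hmem⟩ := S.exists_local_sections c
  have key : ContinuousOn (fun c => ((S.fiber c).card : ℂ)⁻¹ * ∑ d ∈ S.fiber c, f d) U := by
    rw [continuousOn_iff_continuous_domRestrict]
    have : U.domRestrict (fun c => ((S.fiber c).card : ℂ)⁻¹ * ∑ d ∈ S.fiber c, f d) =
        fun x : U => (n : ℂ)⁻¹ * ∑ i, f (s i x) := by
      funext x
      have h1 := S.sum_fiber_eq (fun i => s i x) (hinj x) (hmem x) f
      have h2 := S.card_fiber_eq (fun i => s i x) (hinj x) (hmem x)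
      simp [h1, h2]
    rw [this]
    have := fun i => f.continuous.comp (hs i)
    simp only [Function.comp_def] at this
    fun_prop
  exact key.continuousAt (hU.mem_nhds hc)

/-- The normalized transfer operator
`L(f)(c) = |σ⁻¹(c)|⁻¹ ∑_{σ(d) = c} f(d)`. -/
def transfer : C(C, ℂ) →ₗ[ℂ] C(C, ℂ) where
  toFun f := ⟨fun c => ((S.fiber c).card : ℂ)⁻¹ * ∑ d ∈ S.fiber c, f d, S.continuous_transfer f⟩
  map_add' f g := by ext c; simp [Finset.sum_add_distrib, mul_add]
  map_smul' z f := by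
    ext c
    simp only [ContinuousMap.coe_mk, ContinuousMap.smul_apply, smul_eq_mul, RingHom.id_apply,
      ← Finset.mul_sum]
    ring

theorem transfer_apply (f : C(C, ℂ)) (c : C) :
    S.transfer f c = ((S.fiber c).card : ℂ)⁻¹ * ∑ d ∈ S.fiber c, f d := rfl

theorem transfer_endo_mul (a f : C(C, ℂ)) :
    S.transfer (S.endo a * f) = a * S.transfer f := by
  ext c
  simp only [transfer_apply, ContinuousMap.mul_apply]
  rw [Finset.sum_congr rfl (g := fun d => a c * f d), ← Finset.mul_sum]
  · ring
  · intro d hd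
    rw [endo_apply, S.mem_fiber.mp hd]

theorem transfer_star (f : C(C, ℂ)) : S.transfer (star f) = star (S.transfer f) := by
  ext c
  simp [transfer_apply]

theorem transfer_nonneg {f : C(C, ℂ)} (hf : 0 ≤ f) : 0 ≤ S.transfer f := by
  intro c
  change 0 ≤ S.transfer f c
  rw [transfer_apply]
  exact mul_nonneg (by simp) (Finset.sum_nonneg fun d _ => hf d)

theorem exists_card_fiber_le : ∃ K : ℕ, ∀ c, (S.fiber c).card ≤ K := by
  choose U n s hU hc _ hinj hmem using S.exists_local_sections
  obtain ⟨t, ht⟩ := isCompact_univ.elim_nhds_subcover U fun x _ => (hU x).mem_nhds (hc x)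
  refine ⟨t.sup n, fun c => ?_⟩
  obtain ⟨x, hx, hcx⟩ := Set.mem_iUnion₂.mp (ht.2 (Set.mem_univ c))
  rw [S.card_fiber_eq (fun i => s x i ⟨c, hcx⟩) (hinj x _) (hmem x ⟨c, hcx⟩)]
  exact Finset.le_sup hx

/-- On positive functions, `L` is bounded below. -/
theorem exists_norm_le_transfer : ∃ K : ℝ, 0 ≤ K ∧ ∀ f : C(C, ℂ), 0 ≤ f →
    ‖f‖ ≤ K * ‖S.transfer f‖ := by
  obtain ⟨K, hK⟩ := S.exists_card_fiber_le
  refine ⟨K, by positivity, fun f hf => ?_⟩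
  rw [ContinuousMap.norm_le _ (by positivity)]
  intro d
  have h1 : f d ≤ ∑ d' ∈ S.fiber (S.map d), f d' :=
    Finset.single_le_sum (f := fun d' => f d') (fun d' _ => hf d') (S.mem_fiber.mpr rfl)
  have h2 : ∑ d' ∈ S.fiber (S.map d), f d' =
      ((S.fiber (S.map d)).card : ℂ) * S.transfer f (S.map d) := by
    have := (S.card_fiber_pos (S.map d)).ne'
    rw [transfer_apply, mul_inv_cancel_left₀ (by exact_mod_cast this)]
  have h3 : ‖f d‖ ≤ ‖((S.fiber (S.map d)).card : ℂ) * S.transfer f (S.map d)‖ := by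
    rw [← h2]
    have h0 : 0 ≤ f d := hf d
    have e1 := Complex.re_le_re h1
    have e3 : ‖f d‖ = (f d).re := by
      conv_rhs => rw [Complex.eq_coe_norm_of_nonneg h0]
      simp
    rw [e3]
    exact e1.trans (Complex.re_le_norm _)
  refine h3.trans ?_
  rw [norm_mul, Complex.norm_natCast]
  gcongr
  · exact_mod_cast hK _
  · exact ContinuousMap.norm_coe_le_norm _ _

theorem transferPow_endo_mul (k : ℕ) (a f : C(C, ℂ)) :
    (S.transfer ^ k) ((S.endo ^ k) a * f) = a * (S.transfer ^ k) f := by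
  induction k generalizing a f with
  | zero => rfl
  | succ k ih =>
    have e1 : (S.endo ^ (k + 1)) a = S.endo ((S.endo ^ k) a) := by rw [pow_succ']; rfl
    have e2 : ∀ g, (S.transfer ^ (k + 1)) g = (S.transfer ^ k) (S.transfer g) := by
      intro g; rw [pow_succ]; rfl
    rw [e1, e2, e2, transfer_endo_mul, ih]

theorem transferPow_star (k : ℕ) (f : C(C, ℂ)) :
    (S.transfer ^ k) (star f) = star ((S.transfer ^ k) f) := by
  induction k generalizing f with
  | zero => rfl
  | succ k ih =>
    have e2 : ∀ g, (S.transfer ^ (k + 1)) g = (S.transfer ^ k) (S.transfer g) := by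
      intro g; rw [pow_succ]; rfl
    rw [e2, e2, transfer_star, ih]

theorem transferPow_nonneg (k : ℕ) {f : C(C, ℂ)} (hf : 0 ≤ f) : 0 ≤ (S.transfer ^ k) f := by
  induction k generalizing f with
  | zero => exact hf
  | succ k ih =>
    have e2 : ∀ g, (S.transfer ^ (k + 1)) g = (S.transfer ^ k) (S.transfer g) := by
      intro g; rw [pow_succ]; rfl
    rw [e2]
    exact ih (S.transfer_nonneg hf)

theorem exists_norm_le_transferPow (k : ℕ) : ∃ K : ℝ, 0 ≤ K ∧ ∀ f : C(C, ℂ), 0 ≤ f →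
    ‖f‖ ≤ K * ‖(S.transfer ^ k) f‖ := by
  obtain ⟨K, hK, h⟩ := S.exists_norm_le_transfer
  refine ⟨K ^ k, by positivity, ?_⟩
  induction k with
  | zero => intro f _; simp
  | succ k ih =>
    intro f hf
    have e2 : ∀ g, (S.transfer ^ (k + 1)) g = (S.transfer ^ k) (S.transfer g) := by
      intro g; rw [pow_succ]; rfl
    calc ‖f‖ ≤ K * ‖S.transfer f‖ := h f hf
      _ ≤ K * (K ^ k * ‖(S.transfer ^ k) (S.transfer f)‖) := by
        gcongr
        exact ih _ (S.transfer_nonneg hf)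
      _ = _ := by rw [e2]; ring

end ExelSystem
section

/-- A (complete) Hilbert `C(C)`-module. As `C(C)` is commutative, the right action
`x · f` is written `f • x`. -/
structure HilbertModule (C : Type w) [TopologicalSpace C] [CompactSpace C] where
  /-- the underlying space -/
  carrier : Type u
  [instNormedAddCommGroup : NormedAddCommGroup carrier]
  [instNormedSpace : NormedSpace ℂ carrier]
  [instSMul : SMul C(C, ℂ) carrier]
  [instCStarModule : CStarModule C(C, ℂ) carrier]
  [instCompleteSpace : CompleteSpace carrier]

/-- A pre-inner-product `C(C)`-module: the inner product may be degenerate. -/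
structure PreHilbertModule (C : Type w) [TopologicalSpace C] [CompactSpace C] where
  /-- the underlying space -/
  carrier : Type u
  [instAddCommGroup : AddCommGroup carrier]
  [instModule : Module ℂ carrier]
  [instSMul : SMul C(C, ℂ) carrier]
  [instInner : Inner C(C, ℂ) carrier]
  inner_add_right (x y z : carrier) :
    inner C(C, ℂ) x (y + z) = inner C(C, ℂ) x y + inner C(C, ℂ) x z
  inner_smul_right_complex (a : ℂ) (x y : carrier) :
    inner C(C, ℂ) x (a • y) = a • inner C(C, ℂ) x y
  inner_smul_right (a : C(C, ℂ)) (x y : carrier) :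
    inner C(C, ℂ) x (a • y) = a * inner C(C, ℂ) x y
  star_inner (x y : carrier) : star (inner C(C, ℂ) x y) = inner C(C, ℂ) y x
  inner_self_nonneg (x : carrier) : 0 ≤ inner C(C, ℂ) x x

attribute [instance] HilbertModule.instNormedAddCommGroup HilbertModule.instNormedSpace
  HilbertModule.instSMul HilbertModule.instCStarModule HilbertModule.instCompleteSpace
  PreHilbertModule.instAddCommGroup PreHilbertModule.instModule
  PreHilbertModule.instSMul PreHilbertModule.instInner

variable {C : Type w} [TopologicalSpace C] [CompactSpace C]

theorem isClosed_nonneg_continuousMap : IsClosed {f : C(C, ℂ) | 0 ≤ f} := by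
  have : {f : C(C, ℂ) | 0 ≤ f} = ⋂ c, {f : C(C, ℂ) | 0 ≤ f c} := by
    ext f; simp [ContinuousMap.le_def]
  rw [this]
  exact isClosed_iInter fun c => isClosed_le continuous_const (by fun_prop)

namespace PreHilbertModule

variable (P : PreHilbertModule.{u} C)

theorem inner_add_left (x y z : P.carrier) :
    inner C(C, ℂ) (x + y) z = inner C(C, ℂ) x z + inner C(C, ℂ) y z := by
  rw [← P.star_inner z (x + y), P.inner_add_right, star_add, P.star_inner, P.star_inner]

theorem inner_smul_left_complex (a : ℂ) (x y : P.carrier) :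
    inner C(C, ℂ) (a • x) y = star a • inner C(C, ℂ) x y := by
  rw [← P.star_inner y (a • x), P.inner_smul_right_complex, star_smul, P.star_inner]

theorem inner_smul_left (a : C(C, ℂ)) (x y : P.carrier) :
    inner C(C, ℂ) (a • x) y = star a * inner C(C, ℂ) x y := by
  rw [← P.star_inner y (a • x), P.inner_smul_right, star_mul, P.star_inner, mul_comm]

theorem inner_sub_right (x y z : P.carrier) :
    inner C(C, ℂ) x (y - z) = inner C(C, ℂ) x y - inner C(C, ℂ) x z := by
  rw [eq_sub_iff_add_eq, ← P.inner_add_right, sub_add_cancel]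

theorem inner_sub_left (x y z : P.carrier) :
    inner C(C, ℂ) (x - y) z = inner C(C, ℂ) x z - inner C(C, ℂ) y z := by
  rw [eq_sub_iff_add_eq, ← P.inner_add_left, sub_add_cancel]

/-- Evaluation of the inner product at a point is a scalar-valued pre-inner product. -/
@[reducible] def core (c : C) : PreInnerProductSpace.Core ℂ P.carrier where
  inner x y := inner C(C, ℂ) x y c
  conj_inner_symm x y := by
    rw [← P.star_inner y x]; rfl
  re_inner_nonneg x := (Complex.nonneg_iff.mp (P.inner_self_nonneg x c)).1
  add_left x y z := by rw [P.inner_add_left]; rfl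
  smul_left x y r := by rw [P.inner_smul_left_complex]; rfl

theorem norm_inner_self_apply (x : P.carrier) (c : C) :
    ‖inner C(C, ℂ) x x c‖ = (inner C(C, ℂ) x x c).re := by
  have h : 0 ≤ inner C(C, ℂ) x x c := P.inner_self_nonneg x c
  conv_rhs => rw [Complex.eq_coe_norm_of_nonneg h]
  simp

/-- The seminorm `‖x‖ = ‖⟨x, x⟩‖ ^ (1/2)`. -/
instance : Norm P.carrier := ⟨fun x => √‖inner C(C, ℂ) x x‖⟩

theorem norm_def (x : P.carrier) : ‖x‖ = √‖inner C(C, ℂ) x x‖ := rfl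

theorem norm_sq (x : P.carrier) : ‖x‖ ^ 2 = ‖inner C(C, ℂ) x x‖ := by
  rw [norm_def, Real.sq_sqrt (norm_nonneg _)]

theorem pointwise_norm_le (x : P.carrier) (c : C) : √(inner C(C, ℂ) x x c).re ≤ ‖x‖ := by
  rw [norm_def, ← norm_inner_self_apply]
  exact Real.sqrt_le_sqrt (ContinuousMap.norm_coe_le_norm _ _)

theorem norm_le_of_pointwise (x : P.carrier) {M : ℝ} (hM : 0 ≤ M)
    (h : ∀ c, √(inner C(C, ℂ) x x c).re ≤ M) : ‖x‖ ≤ M := by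
  rw [norm_def, Real.sqrt_le_left hM, ContinuousMap.norm_le _ (by positivity)]
  intro c
  rw [norm_inner_self_apply, ← Real.sqrt_le_left hM]
  exact h c

theorem norm_inner_le (x y : P.carrier) : ‖inner C(C, ℂ) x y‖ ≤ ‖x‖ * ‖y‖ := by
  have hx : 0 ≤ ‖x‖ := Real.sqrt_nonneg _
  have hy : 0 ≤ ‖y‖ := Real.sqrt_nonneg _
  rw [ContinuousMap.norm_le _ (mul_nonneg hx hy)]
  intro c
  refine (@InnerProductSpace.Core.norm_inner_le_norm ℂ P.carrier _ _ _ (P.core c) x y).trans ?_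
  exact mul_le_mul (P.pointwise_norm_le x c) (P.pointwise_norm_le y c) (Real.sqrt_nonneg _) hx

theorem seminormedCore : SeminormedSpace.Core ℂ P.carrier where
  norm_nonneg _ := Real.sqrt_nonneg _
  norm_smul z x := by
    rw [norm_def, norm_def, P.inner_smul_right_complex, P.inner_smul_left_complex, smul_smul,
      norm_smul, Real.sqrt_mul (norm_nonneg _)]
    congr 1
    simp
  norm_triangle x y := by
    refine P.norm_le_of_pointwise _ (add_nonneg (Real.sqrt_nonneg _) (Real.sqrt_nonneg _)) ?_
    intro c
    let _ := P.core c
    have h := @norm_add_le P.carrier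
      (InnerProductSpace.Core.toSeminormedAddCommGroup (𝕜 := ℂ)).toSeminormedAddGroup x y
    exact h.trans (add_le_add (P.pointwise_norm_le x c) (P.pointwise_norm_le y c))

instance : SeminormedAddCommGroup P.carrier := SeminormedAddCommGroup.ofCore P.seminormedCore

instance : NormedSpace ℂ P.carrier where
  norm_smul_le z x := (P.seminormedCore.norm_smul z x).le

theorem norm_smul_sub_le (a : C(C, ℂ)) (x y : P.carrier) :
    ‖a • x - a • y‖ ≤ ‖a‖ * ‖x - y‖ := by
  have h : inner C(C, ℂ) (a • x - a • y) (a • x - a • y) =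
      (star a * a) * inner C(C, ℂ) (x - y) (x - y) := by
    simp only [inner_sub_left, inner_sub_right, inner_smul_left, inner_smul_right]
    ring
  rw [norm_def, norm_def, h]
  calc √‖star a * a * inner C(C, ℂ) (x - y) (x - y)‖
      ≤ √(‖a‖ ^ 2 * ‖inner C(C, ℂ) (x - y) (x - y)‖) := by
        refine Real.sqrt_le_sqrt ((norm_mul_le _ _).trans ?_)
        rw [CStarRing.norm_star_mul_self, sq]
    _ = _ := by rw [Real.sqrt_mul (by positivity), Real.sqrt_sq (norm_nonneg _)]

instance : UniformContinuousConstSMul C(C, ℂ) P.carrier where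
  uniformContinuous_const_smul a := by
    refine (LipschitzWith.of_dist_le_mul (K := ‖a‖₊) fun x y => ?_).uniformContinuous
    rw [dist_eq_norm, dist_eq_norm]
    exact P.norm_smul_sub_le a x y

/-- The inner product as a continuous sesquilinear map. -/
def innerSL : P.carrier →L⋆[ℂ] P.carrier →L[ℂ] C(C, ℂ) :=
  LinearMap.mkContinuous₂ (LinearMap.mk₂'ₛₗ (starRingEnd ℂ) (RingHom.id ℂ)
    (fun x y : P.carrier => inner C(C, ℂ) x y) P.inner_add_left
    (fun a x y => P.inner_smul_left_complex a x y) P.inner_add_right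
    (fun a x y => P.inner_smul_right_complex a x y)) 1 fun x y => by
      simpa using P.norm_inner_le x y

theorem continuous_inner :
    Continuous fun p : P.carrier × P.carrier => inner C(C, ℂ) p.1 p.2 := by
  have : (fun p : P.carrier × P.carrier => inner C(C, ℂ) p.1 p.2) =
      fun p => P.innerSL p.1 p.2 := rfl
  rw [this]
  fun_prop

open UniformSpace

/-- The Hausdorff completion of a pre-inner-product module (as a type). -/
def Compl : Type u := Completion P.carrier

instance : NormedAddCommGroup P.Compl := inferInstanceAs (NormedAddCommGroup (Completion P.carrier))
instance : NormedSpace ℂ P.Compl := inferInstanceAs (NormedSpace ℂ (Completion P.carrier))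
instance : SMul C(C, ℂ) P.Compl := inferInstanceAs (SMul C(C, ℂ) (Completion P.carrier))
instance : UniformContinuousConstSMul C(C, ℂ) P.Compl :=
  inferInstanceAs (UniformContinuousConstSMul C(C, ℂ) (Completion P.carrier))
instance : CompleteSpace P.Compl := inferInstanceAs (CompleteSpace (Completion P.carrier))
/-- The inner product of the completion: the continuous extension of the given one. -/
instance : Inner C(C, ℂ) P.Compl := inferInstanceAs (Inner C(C, ℂ) (Completion P.carrier))

/-- The canonical map into the completion. -/
def toCompl : P.carrier →ₗ[ℂ] P.Compl := (Completion.toComplₗᵢ (𝕜 := ℂ)).toLinearMap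

theorem norm_toCompl (x : P.carrier) : ‖P.toCompl x‖ = ‖x‖ := Completion.norm_coe x

theorem continuous_toCompl : Continuous P.toCompl := Completion.continuous_coe _

theorem denseRange_toCompl : DenseRange P.toCompl := Completion.denseRange_coe

theorem toCompl_smul (a : C(C, ℂ)) (x : P.carrier) : P.toCompl (a • x) = a • P.toCompl x :=
  Completion.coe_smul a x

theorem inner_toCompl (x y : P.carrier) :
    inner C(C, ℂ) (P.toCompl x) (P.toCompl y) = inner C(C, ℂ) x y :=
  (Completion.isDenseInducing_coe.prodMap Completion.isDenseInducing_coe).extend_eq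
    (f := Function.uncurry (inner C(C, ℂ))) P.continuous_inner (x, y)

theorem continuous_inner_compl :
    Continuous fun p : P.Compl × P.Compl => inner C(C, ℂ) p.1 p.2 := by
  let inner' : P.carrier →+ P.carrier →+ C(C, ℂ) :=
    AddMonoidHom.mk' (fun x => (P.innerSL x).toLinearMap.toAddMonoidHom)
      fun x y => by ext z; simp
  have h : Continuous fun p : P.carrier × P.carrier => inner' p.1 p.2 := P.continuous_inner
  exact (Completion.isDenseInducing_toCompl P.carrier).extend_Z_bilin
    (Completion.isDenseInducing_toCompl P.carrier) h

@[fun_prop]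
theorem Continuous_inner_compl {α : Type*} [TopologicalSpace α] {f g : α → P.Compl}
    (hf : Continuous f) (hg : Continuous g) :
    Continuous fun a => inner C(C, ℂ) (f a) (g a) :=
  P.continuous_inner_compl.comp (hf.prodMk hg)

@[elab_as_elim]
theorem compl_induction {p : P.Compl → Prop} (hp : IsClosed {x | p x})
    (h : ∀ x, p (P.toCompl x)) (x : P.Compl) : p x :=
  Completion.induction_on x hp h

theorem norm_compl (x : P.Compl) : ‖x‖ = √‖inner C(C, ℂ) x x‖ := by
  induction x using P.compl_induction with
  | hp => exact isClosed_eq (by fun_prop) (by fun_prop)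
  | h x => rw [norm_toCompl, inner_toCompl, norm_def]

theorem continuous_smul_compl (a : C(C, ℂ)) : Continuous fun x : P.Compl => a • x :=
  (uniformContinuous_const_smul a).continuous

theorem inner_smul_compl (a : C(C, ℂ)) (x y : P.Compl) :
    inner C(C, ℂ) x (a • y) = a * inner C(C, ℂ) x y := by
  have ha := P.continuous_smul_compl a
  induction x using P.compl_induction with
  | hp =>
    exact isClosed_eq (Continuous_inner_compl P continuous_id continuous_const)
      (continuous_const.mul (Continuous_inner_compl P continuous_id continuous_const))
  | h x =>
  induction y using P.compl_induction with
  | hp =>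
    exact isClosed_eq (Continuous_inner_compl P continuous_const ha)
      (continuous_const.mul (Continuous_inner_compl P continuous_const continuous_id))
  | h y => rw [← toCompl_smul, inner_toCompl, inner_toCompl, P.inner_smul_right]

theorem inner_smul_complex_compl (a : ℂ) (x y : P.Compl) :
    inner C(C, ℂ) x (a • y) = a • inner C(C, ℂ) x y := by
  have ha : Continuous fun y : P.Compl => a • y := continuous_const_smul a
  have hb : Continuous fun f : C(C, ℂ) => a • f := continuous_const_smul a
  induction x using P.compl_induction with
  | hp =>
    exact isClosed_eq (Continuous_inner_compl P continuous_id continuous_const)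
      (hb.comp (Continuous_inner_compl P continuous_id continuous_const))
  | h x =>
  induction y using P.compl_induction with
  | hp =>
    exact isClosed_eq (Continuous_inner_compl P continuous_const ha)
      (hb.comp (Continuous_inner_compl P continuous_const continuous_id))
  | h y => rw [← map_smul, inner_toCompl, inner_toCompl, P.inner_smul_right_complex]

instance : CStarModule C(C, ℂ) P.Compl where
  inner_add_right := by
    intro x y z
    induction x using P.compl_induction with
    | hp => exact isClosed_eq (by fun_prop) (by fun_prop)
    | h x =>
    induction y using P.compl_induction with
    | hp => exact isClosed_eq (by fun_prop) (by fun_prop)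
    | h y =>
    induction z using P.compl_induction with
    | hp => exact isClosed_eq (by fun_prop) (by fun_prop)
    | h z =>
    rw [← map_add, inner_toCompl, inner_toCompl, inner_toCompl, P.inner_add_right]
  inner_self_nonneg := by
    intro x
    induction x using P.compl_induction with
    | hp =>
      have hc : Continuous fun x : P.Compl => inner C(C, ℂ) x x := by fun_prop
      exact isClosed_nonneg_continuousMap.preimage hc
    | h x => rw [inner_toCompl]; exact P.inner_self_nonneg x
  inner_self := by
    intro x
    constructor
    · intro h
      rw [← norm_eq_zero, norm_compl, h]; simp
    · intro h
      have := P.norm_compl x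
      rwa [h, norm_zero, eq_comm, Real.sqrt_eq_zero (norm_nonneg _), norm_eq_zero, ← h] at this
  inner_op_smul_right := P.inner_smul_compl _ _ _
  inner_smul_right_complex := P.inner_smul_complex_compl _ _ _
  star_inner := by
    intro x y
    induction x using P.compl_induction with
    | hp => exact isClosed_eq (by fun_prop) (by fun_prop)
    | h x =>
    induction y using P.compl_induction with
    | hp => exact isClosed_eq (by fun_prop) (by fun_prop)
    | h y =>
    rw [inner_toCompl, inner_toCompl, P.star_inner]
  norm_eq_sqrt_norm_inner_self := P.norm_compl

/-- The completion of a pre-inner-product module, as a Hilbert module. -/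
def completion : HilbertModule.{u} C where
  carrier := P.Compl

/-- The canonical map of a pre-inner-product module into its completion. -/
def toCompletion : P.carrier →ₗ[ℂ] P.completion.carrier := P.toCompl

theorem toCompletion_smul (a : C(C, ℂ)) (x : P.carrier) : P.toCompletion (a • x) = a • P.toCompletion x := P.toCompl_smul a x

theorem inner_toCompletion (x y : P.carrier) :
    inner C(C, ℂ) (P.toCompletion x) (P.toCompletion y) = inner C(C, ℂ) x y := P.inner_toCompl x y

end PreHilbertModule

/-- An inner-product preserving module map between Hilbert modules (it need not be adjointable
nor surjective; a Hilbert-module isomorphism is a surjective one). -/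
structure IPMap (X : HilbertModule.{u} C) (Y : HilbertModule.{v} C) extends
    X.carrier →ₗ[ℂ] Y.carrier where
  map_action (a : C(C, ℂ)) (x : X.carrier) : toFun (a • x) = a • toFun x
  inner_map (x y : X.carrier) : inner C(C, ℂ) (toFun x) (toFun y) = inner C(C, ℂ) x y

namespace IPMap

variable {X : HilbertModule.{u} C} {Y : HilbertModule.{v} C}

instance : CoeFun (IPMap X Y) fun _ => X.carrier → Y.carrier := ⟨fun T => T.toLinearMap⟩

/-- `T` has an adjoint. -/
def IsAdjointable (T : IPMap X Y) : Prop :=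
  ∃ T' : Y.carrier → X.carrier, ∀ x y, inner C(C, ℂ) (T x) y = inner C(C, ℂ) x (T' y)

theorem norm_map (T : IPMap X Y) (x : X.carrier) : ‖T x‖ = ‖x‖ := by
  rw [CStarModule.norm_eq_sqrt_norm_inner_self (A := C(C, ℂ)),
    CStarModule.norm_eq_sqrt_norm_inner_self (A := C(C, ℂ)) x]
  congr 2
  exact T.inner_map x x

end IPMap

namespace PreHilbertModule

variable (P : PreHilbertModule.{u} C) {Z : HilbertModule.{v} C}

theorem norm_eq_of_inner (f : P.carrier →ₗ[ℂ] Z.carrier)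
    (hf : ∀ x y, inner C(C, ℂ) (f x) (f y) = inner C(C, ℂ) x y) (x : P.carrier) :
    ‖f x‖ = ‖x‖ := by
  rw [CStarModule.norm_eq_sqrt_norm_inner_self (A := C(C, ℂ)), hf]; rfl

theorem uniformContinuous_of_inner (f : P.carrier →ₗ[ℂ] Z.carrier)
    (hf : ∀ x y, inner C(C, ℂ) (f x) (f y) = inner C(C, ℂ) x y) : UniformContinuous f := by
  refine (LipschitzWith.of_dist_le_mul (K := 1) fun x y => ?_).uniformContinuous
  rw [dist_eq_norm, dist_eq_norm, ← map_sub, P.norm_eq_of_inner f hf]; simp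

theorem continuous_smul_hilbert (a : C(C, ℂ)) : Continuous fun z : Z.carrier => a • z := by
  refine (LipschitzWith.of_dist_le_mul (K := ‖a‖₊) fun x y => ?_).continuous
  rw [dist_eq_norm, dist_eq_norm]
  have h : inner C(C, ℂ) (a • x - a • y) (a • x - a • y) =
      (star a * a) * inner C(C, ℂ) (x - y) (x - y) := by
    simp only [CStarModule.inner_sub_left, CStarModule.inner_sub_right,
      CStarModule.inner_op_smul_left, CStarModule.inner_op_smul_right]
    ring
  rw [CStarModule.norm_eq_sqrt_norm_inner_self (A := C(C, ℂ)), h,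
    CStarModule.norm_eq_sqrt_norm_inner_self (A := C(C, ℂ)) (x - y)]
  calc √‖star a * a * inner C(C, ℂ) (x - y) (x - y)‖
      ≤ √(‖a‖ ^ 2 * ‖inner C(C, ℂ) (x - y) (x - y)‖) := by
        refine Real.sqrt_le_sqrt ((norm_mul_le _ _).trans ?_)
        rw [CStarRing.norm_star_mul_self, sq]
    _ = _ := by rw [Real.sqrt_mul (by positivity), Real.sqrt_sq (norm_nonneg _)]; rfl

open UniformSpace

/-- The continuous extension of a map to the completion. -/
def extend (f : P.carrier → Z.carrier) : P.Compl → Z.carrier := Completion.extension f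

theorem continuous_extend (f : P.carrier → Z.carrier) : Continuous (P.extend f) :=
  Completion.continuous_extension

theorem extend_toCompl {f : P.carrier → Z.carrier} (hf : UniformContinuous f) (x : P.carrier) :
    P.extend f (P.toCompl x) = f x :=
  Completion.extension_coe hf x

/-- The continuous extension to the completion of an inner-product preserving module map. -/
def lift (f : P.carrier →ₗ[ℂ] Z.carrier) (hA : ∀ (a : C(C, ℂ)) x, f (a • x) = a • f x)
    (hf : ∀ x y, inner C(C, ℂ) (f x) (f y) = inner C(C, ℂ) x y) :
    IPMap P.completion Z :=
  have hu := P.uniformContinuous_of_inner f hf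
  have hc := P.continuous_extend f
  have hcz : Continuous fun p : Z.carrier × Z.carrier => inner C(C, ℂ) p.1 p.2 :=
    CStarModule.continuous_inner
  { toFun := P.extend f
    map_add' := fun (x y : P.Compl) => by
      change P.extend f (x + y) = P.extend f x + P.extend f y
      induction x using P.compl_induction with
      | hp => exact isClosed_eq (by fun_prop) (by fun_prop)
      | h x =>
      induction y using P.compl_induction with
      | hp => exact isClosed_eq (by fun_prop) (by fun_prop)
      | h y => rw [← map_add, extend_toCompl P hu, extend_toCompl P hu, extend_toCompl P hu, map_add]
    map_smul' := fun a (x : P.Compl) => by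
      change P.extend f (a • x) = a • P.extend f x
      induction x using P.compl_induction with
      | hp => exact isClosed_eq (hc.comp (continuous_const_smul a)) (hc.const_smul a)
      | h x =>
        rw [← map_smul, extend_toCompl P hu, extend_toCompl P hu, map_smul]
    map_action := fun a (x : P.Compl) => by
      have h1 := P.continuous_smul_compl a
      have h2 := continuous_smul_hilbert (Z := Z) a
      change P.extend f (a • x) = a • P.extend f x
      induction x using P.compl_induction with
      | hp => exact isClosed_eq (hc.comp h1) (h2.comp hc)
      | h x => rw [← toCompl_smul, extend_toCompl P hu, extend_toCompl P hu, hA]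
    inner_map := fun (x y : P.Compl) => by
      change inner C(C, ℂ) (P.extend f x) (P.extend f y) = inner C(C, ℂ) x y
      induction x using P.compl_induction with
      | hp => exact isClosed_eq (hcz.comp (hc.prodMk continuous_const)) (by fun_prop)
      | h x =>
      induction y using P.compl_induction with
      | hp => exact isClosed_eq (hcz.comp (continuous_const.prodMk hc)) (by fun_prop)
      | h y => rw [extend_toCompl P hu, extend_toCompl P hu, hf, inner_toCompl] }

theorem lift_toCompletion (f : P.carrier →ₗ[ℂ] Z.carrier)
    (hA : ∀ (a : C(C, ℂ)) x, f (a • x) = a • f x)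
    (hf : ∀ x y, inner C(C, ℂ) (f x) (f y) = inner C(C, ℂ) x y) (x : P.carrier) :
    P.lift f hA hf (P.toCompletion x) = f x :=
  P.extend_toCompl (P.uniformContinuous_of_inner f hf) x

end PreHilbertModule

end

theorem ExelSystem.norm_transferPow_le {C : Type w} [TopologicalSpace C] [CompactSpace C]
    [T2Space C] (S : ExelSystem C) (k : ℕ) (f : C(C, ℂ)) : ‖(S.transfer ^ k) f‖ ≤ ‖f‖ := by
  induction k generalizing f with
  | zero => exact le_rfl
  | succ k ih =>
    have e2 : (S.transfer ^ (k + 1)) f = (S.transfer ^ k) (S.transfer f) := by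
      rw [pow_succ]; rfl
    rw [e2]
    refine (ih _).trans ?_
    rw [ContinuousMap.norm_le _ (norm_nonneg _)]
    intro c
    have hn : (0 : ℝ) < (S.fiber c).card := by exact_mod_cast S.card_fiber_pos c
    rw [S.transfer_apply, norm_mul, norm_inv, Complex.norm_natCast, inv_mul_le_iff₀ hn]
    refine (norm_sum_le _ _).trans ((Finset.sum_le_sum fun d _ =>
      ContinuousMap.norm_coe_le_norm f d).trans ?_)
    simp

namespace HilbertModule

variable {C : Type w} [TopologicalSpace C] [CompactSpace C] (X : HilbertModule.{u} C)

theorem ext_inner {x y : X.carrier}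
    (h : ∀ z, inner C(C, ℂ) z x = inner C(C, ℂ) z y) : x = y := by
  rw [← sub_eq_zero, ← CStarModule.inner_self (A := C(C, ℂ)), CStarModule.inner_sub_right, h,
    sub_self]

theorem action_add (a : C(C, ℂ)) (x y : X.carrier) : a • (x + y) = a • x + a • y :=
  X.ext_inner fun z => by simp [mul_add]

theorem add_action (a b : C(C, ℂ)) (x : X.carrier) : (a + b) • x = a • x + b • x :=
  X.ext_inner fun z => by simp [add_mul]

theorem mul_action (a b : C(C, ℂ)) (x : X.carrier) : (a * b) • x = a • b • x :=
  X.ext_inner fun z => by simp [mul_assoc]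

theorem action_smul (a : C(C, ℂ)) (t : ℂ) (x : X.carrier) : a • t • x = t • a • x :=
  X.ext_inner fun z => by simp

theorem smul_action (t : ℂ) (a : C(C, ℂ)) (x : X.carrier) : (t • a) • x = t • a • x :=
  X.ext_inner fun z => by simp

variable (C) in
/-- The free Hilbert module `C(C)` over `C(C)`, with `⟨f, g⟩ = f* g`. -/
def self : HilbertModule.{w} C where
  carrier := C(C, ℂ)

end HilbertModule

namespace ExelSystem

variable {C : Type w} [TopologicalSpace C] [CompactSpace C] [T2Space C] (S : ExelSystem C)

section Twist

variable (k : ℕ) (X : HilbertModule.{u} C)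

/-- The underlying space of `X_{L^k}`, which is that of `X`. -/
def Twist (_ : ExelSystem C) (_ : ℕ) (X : HilbertModule.{u} C) : Type u := X.carrier

instance : AddCommGroup (S.Twist k X) := inferInstanceAs (AddCommGroup X.carrier)
instance : Module ℂ (S.Twist k X) := inferInstanceAs (Module ℂ X.carrier)

/-- The identity map from `X` to `X_{L^k}`. -/
def twistEquiv : X.carrier ≃ₗ[ℂ] S.Twist k X := LinearEquiv.refl ℂ X.carrier

/-- The module action of `X_{L^k}` is `x · α^k(f)`. -/
instance : SMul C(C, ℂ) (S.Twist k X) :=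
  ⟨fun f x => S.twistEquiv k X ((S.endo ^ k) f • (S.twistEquiv k X).symm x)⟩

/-- The inner product of `X_{L^k}` is `L^k(⟨x, y⟩)`. -/
instance : Inner C(C, ℂ) (S.Twist k X) :=
  ⟨fun x y => (S.transfer ^ k)
    (inner C(C, ℂ) ((S.twistEquiv k X).symm x) ((S.twistEquiv k X).symm y))⟩

instance : Norm (S.Twist k X) := ⟨fun x => √‖inner C(C, ℂ) x x‖⟩

theorem inner_twist (x y : S.Twist k X) : inner C(C, ℂ) x y = (S.transfer ^ k)
    (inner C(C, ℂ) ((S.twistEquiv k X).symm x) ((S.twistEquiv k X).symm y)) := rfl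

theorem twistEquiv_symm_smul (f : C(C, ℂ)) (x : S.Twist k X) :
    (S.twistEquiv k X).symm (f • x) = (S.endo ^ k) f • (S.twistEquiv k X).symm x := rfl

instance : CStarModule C(C, ℂ) (S.Twist k X) where
  inner_add_right {x y z} := by simp [inner_twist]
  inner_self_nonneg {x} := S.transferPow_nonneg k CStarModule.inner_self_nonneg
  inner_self {x} := by
    constructor
    · intro h
      obtain ⟨K, -, hK⟩ := S.exists_norm_le_transferPow k
      have := hK (inner C(C, ℂ) ((S.twistEquiv k X).symm x) ((S.twistEquiv k X).symm x))
        CStarModule.inner_self_nonneg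
      rw [← inner_twist, h, norm_zero, mul_zero, norm_le_zero_iff, CStarModule.inner_self] at this
      simpa using this
    · rintro rfl
      simp [inner_twist]
  inner_op_smul_right {a x y} := by
    rw [inner_twist, twistEquiv_symm_smul, CStarModule.inner_op_smul_right, transferPow_endo_mul]
    rfl
  inner_smul_right_complex {t x y} := by simp [inner_twist]
  star_inner x y := by rw [inner_twist, ← transferPow_star, CStarModule.star_inner]; rfl
  norm_eq_sqrt_norm_inner_self _ := rfl

instance : NormedAddCommGroup (S.Twist k X) := CStarModule.normedAddCommGroup C(C, ℂ)

instance : NormedSpace ℂ (S.Twist k X) := .ofCore (CStarModule.normedSpaceCore C(C, ℂ))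

instance : CompleteSpace (S.Twist k X) := by
  obtain ⟨K, hK0, hK⟩ := S.exists_norm_le_transferPow k
  let e : X.carrier ≃L[ℂ] S.Twist k X :=
    (S.twistEquiv k X).toContinuousLinearEquivOfBounds 1 (√K)
      (fun x => by
        rw [one_mul, CStarModule.norm_eq_sqrt_norm_inner_self (A := C(C, ℂ)),
          CStarModule.norm_eq_sqrt_norm_inner_self (A := C(C, ℂ)) x]
        exact Real.sqrt_le_sqrt (S.norm_transferPow_le k _))
      (fun x => by
        rw [CStarModule.norm_eq_sqrt_norm_inner_self (A := C(C, ℂ)),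
          CStarModule.norm_eq_sqrt_norm_inner_self (A := C(C, ℂ)) x, ← Real.sqrt_mul hK0]
        exact Real.sqrt_le_sqrt (hK _ CStarModule.inner_self_nonneg))
  exact (completeSpace_congr (e := e.toEquiv) e.isUniformEmbedding).mp inferInstance

/-- The Hilbert module `X_{L^k}`: the space `X` with module action `x · α^k(f)` and inner product
`L^k(⟨x, y⟩)`. -/
def twist : HilbertModule.{u} C where
  carrier := S.Twist k X

/-- The identity map from `X` to `X_{L^k}`. -/
def tw : X.carrier ≃ₗ[ℂ] (S.twist k X).carrier := S.twistEquiv k X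

theorem tw_symm_smul (f : C(C, ℂ)) (x : (S.twist k X).carrier) :
    (S.tw k X).symm (f • x) = (S.endo ^ k) f • (S.tw k X).symm x := rfl

theorem inner_tw (x y : (S.twist k X).carrier) : inner C(C, ℂ) x y =
    (S.transfer ^ k) (inner C(C, ℂ) ((S.tw k X).symm x) ((S.tw k X).symm y)) := rfl

end Twist

/-- Exel's correspondence `M_L`, as a right Hilbert module: the space `C(C)` with module action
`m · f = m α(f)` and inner product `⟨m, n⟩ = L(m* n)`. -/
def ML : HilbertModule.{w} C := S.twist 1 (HilbertModule.self C)

/-- The element of `M_L` given by a function. -/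
def ofFun : C(C, ℂ) ≃ₗ[ℂ] S.ML.carrier := S.tw 1 (HilbertModule.self C)

/-- The left action of `C(C)` on `M_L` by multiplication. -/
def leftMul (a : C(C, ℂ)) (m : S.ML.carrier) : S.ML.carrier := S.ofFun (a * S.ofFun.symm m)

theorem ofFun_symm_smul (a : C(C, ℂ)) (m : S.ML.carrier) :
    S.ofFun.symm (a • m) = S.endo a * S.ofFun.symm m := rfl

theorem inner_ML (m n : S.ML.carrier) :
    inner C(C, ℂ) m n = S.transfer (S.ofFun.symm n * star (S.ofFun.symm m)) := rfl

section Tensor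

variable (X : HilbertModule.{u} C)

/-- The linear functional `y ⊗ n ↦ ⟨m, ⟨x, y⟩ · n⟩` on `X ⊙ M_L`. -/
def tensorInnerAux (x : X.carrier) (m : S.ML.carrier) :
    X.carrier ⊗[ℂ] S.ML.carrier →ₗ[ℂ] C(C, ℂ) :=
  TensorProduct.lift <| LinearMap.mk₂ ℂ
    (fun (y : X.carrier) (n : S.ML.carrier) =>
      inner C(C, ℂ) m (S.leftMul (inner C(C, ℂ) x y) n))
    (by intros; simp [leftMul, add_mul])
    (by intros; simp [leftMul])
    (by intros; simp [leftMul, mul_add])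
    (by intros; simp [leftMul])

theorem tensorInnerAux_tmul (x y : X.carrier) (m n : S.ML.carrier) :
    S.tensorInnerAux X x m (y ⊗ₜ n) = inner C(C, ℂ) m (S.leftMul (inner C(C, ℂ) x y) n) := rfl

/-- The sesquilinear form on the algebraic tensor product `X ⊙ M_L` with
`⟨x ⊗ m, y ⊗ n⟩ = ⟨m, ⟨x, y⟩ · n⟩`. -/
def tensorInner : X.carrier ⊗[ℂ] S.ML.carrier →ₗ⋆[ℂ] X.carrier ⊗[ℂ] S.ML.carrier →ₗ[ℂ] C(C, ℂ) :=
  TensorProduct.lift <| LinearMap.mk₂'ₛₗ (starRingEnd ℂ) (starRingEnd ℂ) (S.tensorInnerAux X)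
    (by intros; ext; simp [tensorInnerAux_tmul, leftMul, add_mul])
    (by intros; ext; simp [tensorInnerAux_tmul, leftMul])
    (by intros; ext; simp [tensorInnerAux_tmul])
    (by intros; ext; simp [tensorInnerAux_tmul])

theorem tensorInner_tmul (x y : X.carrier) (m n : S.ML.carrier) :
    S.tensorInner X (x ⊗ₜ m) (y ⊗ₜ n) = inner C(C, ℂ) m (S.leftMul (inner C(C, ℂ) x y) n) := rfl

/-- The map `X ⊙ M_L → X`, `x ⊗ f ↦ x · f`. -/
def tensorToModule : X.carrier ⊗[ℂ] S.ML.carrier →ₗ[ℂ] X.carrier :=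
  TensorProduct.lift <| LinearMap.mk₂ ℂ (fun x m => S.ofFun.symm m • x)
    (fun _ _ _ => X.action_add _ _ _)
    (fun _ _ _ => X.action_smul _ _ _)
    (fun _ _ _ => by rw [map_add, X.add_action])
    (fun _ _ _ => by rw [map_smul, X.smul_action])

theorem tensorInner_eq (s t : X.carrier ⊗[ℂ] S.ML.carrier) :
    S.tensorInner X s t =
      S.transfer (inner C(C, ℂ) (S.tensorToModule X s) (S.tensorToModule X t)) := by
  induction s with
  | zero => simp
  | add s s' hs hs' => simp [hs, hs']
  | tmul x m =>
    induction t with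
    | zero => simp
    | add t t' ht ht' => simp [ht, ht']
    | tmul y n =>
      rw [tensorInner_tmul, inner_ML]
      simp only [leftMul, LinearEquiv.symm_apply_apply, tensorToModule, TensorProduct.lift.tmul,
        LinearMap.mk₂_apply, CStarModule.inner_op_smul_right, CStarModule.inner_op_smul_left]
      congr 1
      ring

/-- The right action of `a` on `M_L` as a linear map. -/
def rightMul (a : C(C, ℂ)) : S.ML.carrier →ₗ[ℂ] S.ML.carrier where
  toFun m := a • m
  map_add' := S.ML.action_add a
  map_smul' := S.ML.action_smul a

theorem tensorToModule_rightMul (a : C(C, ℂ)) (t : X.carrier ⊗[ℂ] S.ML.carrier) :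
    S.tensorToModule X ((S.rightMul a).lTensor X.carrier t) = S.endo a • S.tensorToModule X t := by
  induction t with
  | zero =>
    rw [map_zero, map_zero]
    exact X.ext_inner fun z => by simp
  | add s t hs ht => rw [map_add, map_add, hs, ht, map_add, X.action_add]
  | tmul x m =>
    simp only [LinearMap.lTensor_tmul, tensorToModule, TensorProduct.lift.tmul, LinearMap.mk₂_apply]
    rw [← X.mul_action]
    rfl

/-- The algebraic tensor product `X ⊙ M_L` with right action `(x ⊗ m) · a = x ⊗ (m · a)` and
pre-inner product `⟨x ⊗ m, y ⊗ n⟩ = ⟨m, ⟨x, y⟩ · n⟩`. -/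
def preTensor : PreHilbertModule.{max u w} C where
  carrier := X.carrier ⊗[ℂ] S.ML.carrier
  instSMul := ⟨fun a t => (S.rightMul a).lTensor X.carrier t⟩
  instInner := ⟨fun s t => S.tensorInner X s t⟩
  inner_add_right s t t' := map_add _ _ _
  inner_smul_right_complex a s t := map_smul _ _ _
  inner_smul_right a s t := by
    change S.tensorInner X s ((S.rightMul a).lTensor X.carrier t) = a * S.tensorInner X s t
    rw [tensorInner_eq, tensorInner_eq, tensorToModule_rightMul, CStarModule.inner_op_smul_right,
      transfer_endo_mul]
  star_inner s t := by
    change star (S.tensorInner X s t) = S.tensorInner X t s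
    rw [tensorInner_eq, tensorInner_eq, ← transfer_star, CStarModule.star_inner]
  inner_self_nonneg s := by
    change 0 ≤ S.tensorInner X s s
    rw [tensorInner_eq]
    exact S.transfer_nonneg CStarModule.inner_self_nonneg

/-- The internal tensor product `X ⊗_{C(C)} M_L`. -/
def tensor : HilbertModule.{max u w} C := (S.preTensor X).completion

/-- The elementary tensor `x ⊗ m` in `X ⊗_{C(C)} M_L`. -/
def tmul (x : X.carrier) (m : S.ML.carrier) : (S.tensor X).carrier :=
  (S.preTensor X).toCompletion (x ⊗ₜ[ℂ] m)

/-- The identification `X ⊗_{C(C)} M_L → X_L` induced by `x ⊗ f ↦ x · f`. -/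
def tensorTwist : IPMap (S.tensor X) (S.twist 1 X) :=
  (S.preTensor X).lift ((S.tw 1 X).toLinearMap ∘ₗ S.tensorToModule X)
    (fun a t => by
      apply (S.tw 1 X).symm.injective
      rw [tw_symm_smul]
      exact S.tensorToModule_rightMul X a t)
    (fun s t => (S.tensorInner_eq X s t).symm)

theorem tensorTwist_tmul (x : X.carrier) (m : S.ML.carrier) :
    S.tensorTwist X (S.tmul X x m) = S.tw 1 X (S.ofFun.symm m • x) :=
  (S.preTensor X).lift_toCompletion _ _ _ _

variable {X} {Z : HilbertModule.{v} C}

theorem tensorInner_rTensor (T : IPMap X Z) (s t : X.carrier ⊗[ℂ] S.ML.carrier) :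
    S.tensorInner Z (T.toLinearMap.rTensor _ s) (T.toLinearMap.rTensor _ t) =
      S.tensorInner X s t := by
  induction s with
  | zero => simp
  | add s s' hs hs' => simp only [map_add, LinearMap.add_apply, hs, hs']
  | tmul x m =>
    induction t with
    | zero => simp
    | add t t' ht ht' => simp only [map_add, ht, ht']
    | tmul y n =>
      rw [LinearMap.rTensor_tmul, LinearMap.rTensor_tmul, tensorInner_tmul, tensorInner_tmul]
      congr 2
      exact T.inner_map x y

/-- `T ⊗ id : X ⊗ M_L → Z ⊗ M_L` for an inner-product preserving map `T : X → Z`. -/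
def tensorMap (T : IPMap X Z) : IPMap (S.tensor X) (S.tensor Z) :=
  (S.preTensor X).lift (Z := (S.preTensor Z).completion)
    ((S.preTensor Z).toCompletion ∘ₗ T.toLinearMap.rTensor S.ML.carrier)
    (fun a t => by
      have h : T.toLinearMap.rTensor S.ML.carrier ((S.rightMul a).lTensor X.carrier t) =
          (S.rightMul a).lTensor Z.carrier (T.toLinearMap.rTensor S.ML.carrier t) :=
        LinearMap.congr_fun ((LinearMap.rTensor_comp_lTensor _ _ _).trans
          (LinearMap.lTensor_comp_rTensor _ _ _).symm) t
      exact (congrArg (S.preTensor Z).toCompletion h).trans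
        ((S.preTensor Z).toCompletion_smul a _))
    (fun s t => ((S.preTensor Z).inner_toCompletion _ _).trans (S.tensorInner_rTensor T s t))

theorem tensorMap_tmul (T : IPMap X Z) (x : X.carrier) (m : S.ML.carrier) :
    S.tensorMap T (S.tmul X x m) = S.tmul Z (T x) m :=
  (S.preTensor X).lift_toCompletion _ _ _ _

end Tensor

end ExelSystem

namespace HilbertModule

section Limit

variable {C : Type w} [TopologicalSpace C] [CompactSpace C]
  {X : ℕ → HilbertModule.{u} C} (T : ∀ k, IPMap (X k) (X (k + 1)))

/-- The composite `T_{j-1} ∘ ⋯ ∘ T_i : X_i → X_j`. -/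
def transition (i j : ℕ) (h : i ≤ j) : (X i).carrier →ₗ[ℂ] (X j).carrier :=
  Nat.leRec (motive := fun j _ => (X i).carrier →ₗ[ℂ] (X j).carrier) LinearMap.id
    (fun {j} _ f => (T j).toLinearMap ∘ₗ f) h

theorem transition_self (i : ℕ) (x : (X i).carrier) : transition T i i le_rfl x = x := by
  rw [transition, Nat.leRec_self]; rfl

theorem transition_succ (i j : ℕ) (h : i ≤ j) (x : (X i).carrier) :
    transition T i (j + 1) (Nat.le_succ_of_le h) x = T j (transition T i j h x) := by
  rw [transition, Nat.leRec_succ]; rfl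

instance directedSystem :
    DirectedSystem (fun k => (X k).carrier) fun i j h => transition T i j h where
  map_self i x := transition_self T i x
  map_map {k j i} hij hjk x := by
    induction k, hjk using Nat.le_induction with
    | base => rw [transition_self]
    | succ k hjk ih =>
      rw [transition_succ T j k hjk, ih, transition_succ T i k (hij.trans hjk)]

theorem transition_action (a : C(C, ℂ)) (i j : ℕ) (h : i ≤ j) (x : (X i).carrier) :
    transition T i j h (a • x) = a • transition T i j h x := by
  induction j, h using Nat.le_induction with
  | base => rw [transition_self, transition_self]
  | succ j h ih =>
    rw [transition_succ T i j h, ih, transition_succ T i j h]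
    exact (T j).map_action a _

theorem inner_transition (i j : ℕ) (h : i ≤ j) (x y : (X i).carrier) :
    inner C(C, ℂ) (transition T i j h x) (transition T i j h y) = inner C(C, ℂ) x y := by
  induction j, h using Nat.le_induction with
  | base => rw [transition_self, transition_self]
  | succ j h ih =>
    rw [transition_succ, transition_succ, ← ih]
    exact (T j).inner_map _ _

/-- The algebraic direct limit of a sequence of Hilbert modules and inner-product preserving maps:
the quotient of the disjoint union of the `X_k` which identifies `x ∈ X_k` with
`T_k x ∈ X_{k+1}`, with the induced module structure and inner product. -/
def preLimit : PreHilbertModule.{u} C where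
  carrier := DirectLimit (fun k => (X k).carrier) (transition T)
  instSMul := ⟨fun a => DirectLimit.map (transition T) (transition T) (fun _ x => a • x)
    fun i j h x => transition_action T a i j h x⟩
  instInner := ⟨DirectLimit.lift₂ (transition T) (transition T) (fun _ x y => inner C(C, ℂ) x y)
    fun i j h x y => (inner_transition T i j h x y).symm⟩
  inner_add_right x y z := by
    induction x, y, z using DirectLimit.induction₃ with
    | ih i x y z =>
    simp only [inner, DirectLimit.add_def, DirectLimit.lift₂_def]
    exact CStarModule.inner_add_right
  inner_smul_right_complex a x y := by
    induction x, y using DirectLimit.induction₂ with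
    | ih i x y =>
    simp only [inner, DirectLimit.smul_def, DirectLimit.lift₂_def]
    exact CStarModule.inner_smul_right_complex
  inner_smul_right a x y := by
    induction x, y using DirectLimit.induction₂ with
    | ih i x y =>
    simp only [inner, HSMul.hSMul, SMul.smul, DirectLimit.map_def, DirectLimit.lift₂_def]
    exact CStarModule.inner_op_smul_right
  star_inner x y := by
    induction x, y using DirectLimit.induction₂ with
    | ih i x y =>
    simp only [inner, DirectLimit.lift₂_def]
    exact CStarModule.star_inner _ _
  inner_self_nonneg x := by
    induction x using DirectLimit.induction with
    | ih i x =>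
    simp only [inner, DirectLimit.lift₂_def]
    exact CStarModule.inner_self_nonneg

/-- The direct limit `X_∞` of a sequence of Hilbert modules and inner-product preserving maps: the
completion of the algebraic direct limit. -/
def limit : HilbertModule.{u} C := (preLimit T).completion

/-- The class of `x ∈ X_k` in the algebraic direct limit. -/
def toPreLimit (k : ℕ) (x : (X k).carrier) : (preLimit T).carrier :=
  (Quotient.mk _ ⟨k, x⟩ : DirectLimit (fun k => (X k).carrier) (transition T))

theorem toPreLimit_add (k : ℕ) (x y : (X k).carrier) :
    toPreLimit T k (x + y) = toPreLimit T k x + toPreLimit T k y :=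
  (DirectLimit.add_def (G := fun k => (X k).carrier) (f := transition T) k x y).symm

theorem inner_toPreLimit (k : ℕ) (x y : (X k).carrier) :
    inner C(C, ℂ) (toPreLimit T k x) (toPreLimit T k y) = inner C(C, ℂ) x y :=
  DirectLimit.lift₂_def ..

/-- The canonical map `ι^k : X_k → X_∞`. -/
def toLimit (k : ℕ) : IPMap (X k) (limit T) where
  toFun x := (preLimit T).toCompletion (toPreLimit T k x)
  map_add' x y := by rw [toPreLimit_add]; exact map_add _ _ _
  map_smul' a x := (preLimit T).toCompletion.map_smul a (toPreLimit T k x)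
  map_action a x := (preLimit T).toCompletion_smul a (toPreLimit T k x)
  inner_map x y := ((preLimit T).inner_toCompletion _ _).trans (inner_toPreLimit T k x y)

theorem toLimit_succ (k : ℕ) (x : (X k).carrier) :
    toLimit T (k + 1) (T k x) = toLimit T k x := by
  have h : transition T k (k + 1) (Nat.le_succ k) x = T k x := by
    rw [transition_succ T k k le_rfl, transition_self]
  rw [← h]
  exact congrArg (preLimit T).toCompletion
    (DirectLimit.mk_apply (F := fun k => (X k).carrier) (f := transition T) k (k + 1) x (Nat.le_succ k))

end Limit

section Complemented

variable {C : Type w} [TopologicalSpace C] [CompactSpace C] {X : HilbertModule.{u} C}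

/-- A closed submodule of a Hilbert module. -/
def IsClosedSubmodule (V : Submodule ℂ X.carrier) : Prop :=
  IsClosed (V : Set X.carrier) ∧ ∀ (a : C(C, ℂ)), ∀ x ∈ V, a • x ∈ V

/-- `V` is a complemented submodule of the Hilbert module `W` (both given as closed submodules of
`X`): every element of `W` is the sum of an element of `V` and one of `W` orthogonal to `V`. -/
def IsComplementedIn (V W : Submodule ℂ X.carrier) : Prop :=
  IsClosedSubmodule V ∧ IsClosedSubmodule W ∧ V ≤ W ∧
    ∀ x ∈ W, ∃ v ∈ V, ∃ n ∈ W, (∀ v' ∈ V, inner C(C, ℂ) v' n = 0) ∧ v + n = x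

/-- The submodules `V_k` form a projective multi-resolution analysis of the submodule `W` of `X`,
with respect to the dilation operator `D` on `X`. -/
structure IsProjectiveMRA (D : X.carrier ≃ₗ[ℂ] X.carrier) (W : Submodule ℂ X.carrier)
    (V : ℕ → Submodule ℂ X.carrier) : Prop where
  complemented_zero : IsComplementedIn (V 0) W
  eq_preimage (k : ℕ) : (V k : Set X.carrier) = D^[k] ⁻¹' (V 0)
  complemented_succ (k : ℕ) : IsComplementedIn (V k) (V (k + 1))
  le (k : ℕ) : V k ≤ W
  dense : (W : Set X.carrier) ⊆ closure (⋃ k, (V k : Set X.carrier))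

end Complemented

end HilbertModule

namespace ExelSystem

variable {C : Type w} [TopologicalSpace C] [CompactSpace C] [T2Space C] (S : ExelSystem C)

/-- The identity map from `(X_{L^k})_L` to `X_{L^{k+1}}`. -/
def twSucc (k : ℕ) (X : HilbertModule.{u} C) :
    (S.twist 1 (S.twist k X)).carrier ≃ₗ[ℂ] (S.twist (k + 1) X).carrier :=
  (S.tw 1 (S.twist k X)).symm.trans ((S.tw k X).symm.trans (S.tw (k + 1) X))

/-- The tensor powers `M_L^{⊗ k}`, with `M_L^{⊗ 0} = C(C)`, `M_L^{⊗ 1} = M_L` and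
`M_L^{⊗ (k+1)} = M_L^{⊗ k} ⊗ M_L` for `k ≥ 1`. -/
def tensorPow : ℕ → HilbertModule.{w} C
  | 0 => HilbertModule.self C
  | 1 => S.ML
  | k + 2 => S.tensor (tensorPow (k + 1))

/-- A function as an element of `M_L^{⊗ 0} = C(C)`. -/
def scalar (a : C(C, ℂ)) : (S.tensorPow 0).carrier := a

/-- A filter: an element `m` of `M_L` with `⟨m, m⟩ = 1`. -/
def IsFilter (m : S.ML.carrier) : Prop := inner C(C, ℂ) m m = (1 : C(C, ℂ))

/-- For a filter `m`, the map `S_m : C(C) → M_L`, `a ↦ m · a`. -/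
def filterMapZero {m : S.ML.carrier} (hm : S.IsFilter m) : IPMap (HilbertModule.self C) S.ML where
  toFun a := (show C(C, ℂ) from a) • m
  map_add' a b := S.ML.add_action a b m
  map_smul' t a := S.ML.smul_action t a m
  map_action a b := S.ML.mul_action a b m
  inner_map a b := by
    rw [CStarModule.inner_op_smul_right, CStarModule.inner_op_smul_left, hm, one_mul]
    rfl

/-- For a filter `m`, the map `M_L → M_L ⊗ M_L`, `n ↦ m ⊗ n`. -/
def filterMapOne {m : S.ML.carrier} (hm : S.IsFilter m) : IPMap S.ML (S.tensor S.ML) where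
  toFun n := S.tmul S.ML m n
  map_add' n n' := by
    rw [tmul, TensorProduct.tmul_add]; exact map_add _ _ _
  map_smul' t n := by
    rw [tmul, TensorProduct.tmul_smul]; exact map_smul _ _ _
  map_action a n := (S.preTensor S.ML).toCompletion_smul a (m ⊗ₜ[ℂ] n)
  inner_map n n' := by
    refine ((S.preTensor S.ML).inner_toCompletion _ _).trans ?_
    refine (S.tensorInner_tmul S.ML m m n n').trans ?_
    rw [hm, leftMul, one_mul, LinearEquiv.apply_symm_apply]

/-- For a filter `m`, the maps `T_k : M_L^{⊗ k} → M_L^{⊗ (k+1)}`, `T_0 a = m · a` and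
`T_k n = m ⊗ n` for `k ≥ 1`, that is, `T_k (n_1 ⊗ ⋯ ⊗ n_k) = m ⊗ n_1 ⊗ ⋯ ⊗ n_k`. -/
def filterMap {m : S.ML.carrier} (hm : S.IsFilter m) : (k : ℕ) → IPMap (S.tensorPow k) (S.tensorPow (k + 1))
  | 0 => S.filterMapZero hm
  | 1 => S.filterMapOne hm
  | k + 2 => S.tensorMap (filterMap hm (k + 1))

/-- `(X, D, φ)` is a scaling function for the filter `m`: `D : X → X ⊗ M_L` is a Hilbert-module
isomorphism, `⟨φ, φ⟩ = 1` and `D φ = φ ⊗ m`. -/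
structure IsScalingFunction (m : S.ML.carrier) (X : HilbertModule.{u} C)
    (D : IPMap X (S.tensor X)) (φ : X.carrier) : Prop where
  surjective : Function.Surjective D
  inner_self : inner C(C, ℂ) φ φ = (1 : C(C, ℂ))
  map_eq : D φ = S.tmul X φ m

end ExelSystem

end

/-!
A linear bijection `D : X → Y` with `D (x · f) = (D x) · α(f)` and `L ⟨D x, D y⟩ = ⟨x, y⟩`, a
*dilation*, is the same thing as an isomorphism of `X` onto `Y_L = Y ⊗ M_L`. In both parts of the
theorem the modules `X_k` of the directed sequence come with dilations `δ_k : X_{k+1} → X_k` which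
intertwine the maps `T_k`. The dilations `δ_k` pass to a dilation of the limit, which is `R`, and
the maps `q_{k+1} = D⁻¹ q_k δ_k` with `q_0 = Q_0` are compatible, so they induce `Q`, with ranges
`V_{k+1} = D⁻¹ V_k`. Since `T_k` is an adjointable isometry, `V_k` is complemented in `V_{k+1}`.
Hence every `V_k` lies in `V_0 ⊕ V_0^⊥`; this sum is closed, so it contains the closure of
`⋃ V_k`.
-/

universe u₁ u₂ u₃ u₄

noncomputable section

section Orthogonal

variable {A E : Type*} [NonUnitalCStarAlgebra A] [PartialOrder A] [SMul A E]
  [NormedAddCommGroup E] [NormedSpace ℂ E] [CStarModule A E]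

variable (A) in
/-- The orthogonal complement of a subspace of a Hilbert `A`-module, with respect to the
`A`-valued inner product. -/
def innerOrthogonal (V : Submodule ℂ E) : Submodule ℂ E where
  carrier := {x | ∀ v ∈ V, inner A v x = 0}
  add_mem' hx hy v hv := by rw [CStarModule.inner_add_right, hx v hv, hy v hv, add_zero]
  zero_mem' _ _ := CStarModule.inner_zero_right
  smul_mem' t x hx v hv := by rw [CStarModule.inner_smul_right_complex, hx v hv, smul_zero]

theorem mem_innerOrthogonal {V : Submodule ℂ E} {x : E} :
    x ∈ innerOrthogonal A V ↔ ∀ v ∈ V, inner A v x = 0 := Iff.rfl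

variable [StarOrderedRing A]

variable (A) in
theorem norm_le_norm_add_of_inner_eq_zero {x y : E} (h : inner A x y = 0) : ‖x‖ ≤ ‖x + y‖ := by
  have h' : inner A y x = 0 := by rw [← CStarModule.star_inner, h, star_zero]
  have hadd : inner A (x + y) (x + y) = inner A x x + inner A y y := by
    simp only [CStarModule.inner_add_left, CStarModule.inner_add_right, h, h', add_zero, zero_add]
  refine le_of_sq_le_sq ?_ (norm_nonneg _)
  rw [CStarModule.norm_sq_eq A, CStarModule.norm_sq_eq A, hadd]
  exact CStarAlgebra.norm_le_norm_of_nonneg_of_le CStarModule.inner_self_nonneg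
    (le_add_of_nonneg_right CStarModule.inner_self_nonneg)

theorem isClosed_innerOrthogonal (V : Submodule ℂ E) :
    IsClosed (innerOrthogonal A V : Set E) := by
  have h : (innerOrthogonal A V : Set E) = ⋂ v ∈ V, {x | inner A v x = 0} := by
    ext x
    simp only [SetLike.mem_coe, mem_innerOrthogonal, Set.mem_iInter, Set.mem_ofPred_eq]
  rw [h]
  exact isClosed_biInter fun v _ =>
    isClosed_eq (CStarModule.continuous_inner.comp (by fun_prop : Continuous fun x : E => (v, x)))
      continuous_const

theorem isClosed_sup_innerOrthogonal [CompleteSpace E] {V : Submodule ℂ E}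
    (hV : IsClosed (V : Set E)) : IsClosed ((V ⊔ innerOrthogonal A V : Submodule ℂ E) : Set E) := by
  have : CompleteSpace V := hV.completeSpace_coe
  have : CompleteSpace (innerOrthogonal A V) := (isClosed_innerOrthogonal V).completeSpace_coe
  let sum : V × innerOrthogonal A V →L[ℂ] E := V.subtypeL.coprod (innerOrthogonal A V).subtypeL
  have hsum : AntilipschitzWith 1 sum := by
    refine AddMonoidHomClass.antilipschitz_of_bound sum fun p => ?_
    have h : inner A (p.1 : E) (p.2 : E) = 0 := p.2.2 _ p.1.2
    have h' : inner A (p.2 : E) (p.1 : E) = 0 := by rw [← CStarModule.star_inner, h, star_zero]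
    rw [NNReal.coe_one, one_mul]
    exact max_le (norm_le_norm_add_of_inner_eq_zero A h)
      ((norm_le_norm_add_of_inner_eq_zero A h').trans_eq (congrArg norm (add_comm _ _)))
  have hrange : ((V ⊔ innerOrthogonal A V : Submodule ℂ E) : Set E) = Set.range sum := by
    ext x
    simp [sum, Submodule.mem_sup]
  rw [hrange]
  exact hsum.isClosed_range sum.uniformContinuous

end Orthogonal

namespace IPMap

variable {C : Type w} [TopologicalSpace C] [CompactSpace C]
  {X : HilbertModule.{u₁} C} {Y : HilbertModule.{u₂} C} {Z : HilbertModule.{u₃} C}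

theorem apply_smul (T : IPMap X Y) (a : C(C, ℂ)) (x : X.carrier) : T (a • x) = a • T x :=
  T.map_action a x

theorem inner_apply_apply (T : IPMap X Y) (x y : X.carrier) :
    inner C(C, ℂ) (T x) (T y) = inner C(C, ℂ) x y :=
  T.inner_map x y

theorem isometry (T : IPMap X Y) : Isometry T :=
  AddMonoidHomClass.isometry_of_norm T.toLinearMap T.norm_map

theorem isClosed_range (T : IPMap X Y) : IsClosed (Set.range T) :=
  T.isometry.isClosedEmbedding.isClosed_range

theorem surjective_of_denseRange (T : IPMap X Y) (hT : DenseRange T) : Function.Surjective T :=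
  Set.range_eq_univ.mp (T.isClosed_range.closure_eq.symm.trans hT.closure_range)

theorem isClosedSubmodule_range (T : IPMap X Y) :
    HilbertModule.IsClosedSubmodule (LinearMap.range T.toLinearMap) := by
  refine ⟨T.isClosed_range, ?_⟩
  rintro a _ ⟨x, rfl⟩
  exact ⟨a • x, T.apply_smul a x⟩

variable (X) in
/-- The identity map of a Hilbert module. -/
protected def id : IPMap X X where
  toLinearMap := LinearMap.id
  map_action _ _ := rfl
  inner_map _ _ := rfl

/-- The composite of two inner-product preserving module maps. -/
def comp (U : IPMap Y Z) (T : IPMap X Y) : IPMap X Z where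
  toLinearMap := U.toLinearMap ∘ₗ T.toLinearMap
  map_action a x := (congrArg U (T.apply_smul a x)).trans (U.apply_smul a (T x))
  inner_map x y := (U.inner_apply_apply (T x) (T y)).trans (T.inner_apply_apply x y)

theorem comp_apply (U : IPMap Y Z) (T : IPMap X Y) (x : X.carrier) : U.comp T x = U (T x) := rfl

theorem IsAdjointable.isComplementedIn_range_comp {T : IPMap X Y} (hT : T.IsAdjointable)
    (U : IPMap Y Z) : HilbertModule.IsComplementedIn (LinearMap.range (U.comp T).toLinearMap)
      (LinearMap.range U.toLinearMap) := by
  obtain ⟨T', hT'⟩ := hT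
  refine ⟨(U.comp T).isClosedSubmodule_range, U.isClosedSubmodule_range,
    LinearMap.range_comp_le_range _ _, ?_⟩
  -- `T` is an isometry, so `T T'` is the orthogonal projection onto the range of `T`.
  rintro _ ⟨y, rfl⟩
  refine ⟨U (T (T' y)), ⟨T' y, rfl⟩, U (y - T (T' y)), ⟨_, rfl⟩, ?_, ?_⟩
  · rintro _ ⟨x, rfl⟩
    change inner C(C, ℂ) (U (T x)) (U (y - T (T' y))) = 0
    rw [U.inner_apply_apply, CStarModule.inner_sub_right, hT', T.inner_apply_apply, sub_self]
  · rw [← map_add, add_sub_cancel]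

end IPMap

theorem PreHilbertModule.completion_map_ext {C : Type w} [TopologicalSpace C] [CompactSpace C]
    {P : PreHilbertModule.{u} C} {Z : HilbertModule.{v} C} {f g : IPMap P.completion Z}
    (h : ∀ x, f (P.toCompletion x) = g (P.toCompletion x)) (z : P.completion.carrier) :
    f z = g z :=
  congrFun (P.denseRange_toCompl.equalizer f.isometry.continuous g.isometry.continuous
    (funext h)) z

namespace HilbertModule

variable {C : Type w} [TopologicalSpace C] [CompactSpace C]

theorem isComplementedIn_of_dense {X : HilbertModule.{u} C} {V : ℕ → Submodule ℂ X.carrier}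
    {W : Submodule ℂ X.carrier} (hW : IsClosedSubmodule W)
    (hV : ∀ k, IsComplementedIn (V k) (V (k + 1))) (hle : ∀ k, V k ≤ W)
    (hdense : (W : Set X.carrier) ⊆ closure (⋃ k, (V k : Set X.carrier))) :
    IsComplementedIn (V 0) W := by
  have hmono : Monotone V := monotone_nat_of_le_succ fun k => (hV k).2.2.1
  have hsup (k : ℕ) : V k ≤ V 0 ⊔ innerOrthogonal C(C, ℂ) (V 0) := by
    induction k with
    | zero => exact le_sup_left
    | succ k ih =>
      intro x hx
      obtain ⟨v, hv, n, -, hn, rfl⟩ := (hV k).2.2.2 x hx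
      exact add_mem (ih hv) (Submodule.mem_sup_right fun v' hv' => hn v' (hmono k.zero_le hv'))
  refine ⟨(hV 0).1, hW, hle 0, fun x hx => ?_⟩
  have hx' : x ∈ V 0 ⊔ innerOrthogonal C(C, ℂ) (V 0) :=
    closure_minimal (Set.iUnion_subset hsup) (isClosed_sup_innerOrthogonal (hV 0).1.1) (hdense hx)
  obtain ⟨v, hv, n, hn, rfl⟩ := Submodule.mem_sup.mp hx'
  exact ⟨v, hv, n, by simpa using sub_mem hx (hle 0 hv), hn, rfl⟩

section Limit

variable {Z : HilbertModule.{v} C} {X : ℕ → HilbertModule.{u} C}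
  (T : ∀ k, IPMap (X k) (X (k + 1)))

theorem dense_iUnion_range_toLimit : Dense (⋃ k, Set.range (toLimit T k)) := by
  refine Dense.mono ?_ (preLimit T).denseRange_toCompl
  rintro _ ⟨x, rfl⟩
  obtain ⟨k, x, rfl⟩ := DirectLimit.exists_eq_mk (transition T) x
  exact Set.mem_iUnion.mpr ⟨k, x, rfl⟩

theorem limit_map_ext {f g : IPMap (limit T) Z}
    (h : ∀ k x, f (toLimit T k x) = g (toLimit T k x)) (z : (limit T).carrier) : f z = g z := by
  refine PreHilbertModule.completion_map_ext (fun x => ?_) z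
  obtain ⟨k, x, rfl⟩ := DirectLimit.exists_eq_mk (transition T) x
  exact h k x

variable {T} (g : ∀ k, IPMap (X k) Z) (hg : ∀ k x, g (k + 1) (T k x) = g k x)

include hg in
theorem apply_transition (i j : ℕ) (h : i ≤ j) (x : (X i).carrier) :
    g j (transition T i j h x) = g i x := by
  induction j, h using Nat.le_induction with
  | base => rw [transition_self]
  | succ j h ih => rw [transition_succ T i j h, hg, ih]

/-- The map out of the direct limit induced by a compatible family of maps `g k`. -/
def limitLift : IPMap (limit T) Z :=
  (preLimit T).lift
    (DirectLimit.Module.lift ℂ ℕ (fun k => (X k).carrier) (transition T)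
      (fun k => (g k).toLinearMap) (apply_transition g hg))
    (fun a x => by
      obtain ⟨k, x, rfl⟩ := DirectLimit.exists_eq_mk (transition T) x
      exact (g k).apply_smul a x)
    (fun x y => by
      obtain ⟨k, x, y, rfl, rfl⟩ := DirectLimit.exists_eq_mk₂ (transition T) x y
      exact ((g k).inner_apply_apply x y).trans (inner_toPreLimit T k x y).symm)

theorem limitLift_toLimit (k : ℕ) (x : (X k).carrier) :
    limitLift g hg (toLimit T k x) = g k x :=
  (preLimit T).lift_toCompletion _ _ _ _

theorem range_subset_closure_iUnion_range (f : IPMap (limit T) Z) :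
    Set.range f ⊆ closure (⋃ k, Set.range (f.comp (toLimit T k))) := by
  have h := f.isometry.continuous.range_subset_closure_image_dense (dense_iUnion_range_toLimit T)
  simp_rw [Set.image_iUnion, ← Set.range_comp] at h
  exact h

theorem isComplementedIn_range_comp_toLimit_succ {k : ℕ} (hT : (T k).IsAdjointable)
    (f : IPMap (limit T) Z) :
    IsComplementedIn (LinearMap.range (f.comp (toLimit T k)).toLinearMap)
      (LinearMap.range (f.comp (toLimit T (k + 1))).toLinearMap) := by
  have h : (f.comp (toLimit T k)).toLinearMap =
      ((f.comp (toLimit T (k + 1))).comp (T k)).toLinearMap :=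
    LinearMap.ext fun x => congrArg f (toLimit_succ T k x).symm
  rw [h]
  exact hT.isComplementedIn_range_comp _

end Limit

end HilbertModule

namespace ExelSystem

variable {C : Type w} [TopologicalSpace C] [CompactSpace C] [T2Space C] (S : ExelSystem C)

section Dilation

variable {X : HilbertModule.{u₁} C} {Y : HilbertModule.{u₂} C} {Z : HilbertModule.{u₃} C}
  {W : HilbertModule.{u₄} C}

/-- A dilation is a linear bijection `D : X → Y` with `D (x · f) = (D x) · α(f)` and
`L ⟨D x, D y⟩ = ⟨x, y⟩`. It is the same thing as an isomorphism of `X` onto `Y_L = Y ⊗ M_L`, but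
needs no change of module structure. -/
structure IsDilation (D : X.carrier ≃ₗ[ℂ] Y.carrier) : Prop where
  map_smul (f : C(C, ℂ)) (x : X.carrier) : D (f • x) = S.endo f • D x
  transfer_inner (x y : X.carrier) :
    S.transfer (inner C(C, ℂ) (D x) (D y)) = inner C(C, ℂ) x y

namespace IsDilation

variable {S} {D : X.carrier ≃ₗ[ℂ] Y.carrier} {E : Z.carrier ≃ₗ[ℂ] W.carrier}

theorem norm_le_norm_apply (hD : S.IsDilation D) (x : X.carrier) : ‖x‖ ≤ ‖D x‖ := by
  refine le_of_sq_le_sq ?_ (norm_nonneg _)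
  rw [CStarModule.norm_sq_eq C(C, ℂ), CStarModule.norm_sq_eq C(C, ℂ), ← hD.transfer_inner]
  exact S.norm_transferPow_le 1 _

theorem continuous_symm (hD : S.IsDilation D) : Continuous D.symm :=
  AddMonoidHomClass.continuous_of_bound D.symm 1 fun y => by
    simpa using hD.norm_le_norm_apply (D.symm y)

/-- The map `E⁻¹ U D`, where `D` and `E` are dilations: it is the functor `Y ↦ Y_L` on morphisms,
up to the identifications given by `D` and `E`. -/
def conj (hD : S.IsDilation D) (hE : S.IsDilation E) (U : IPMap Y W) : IPMap X Z where
  toLinearMap := E.symm.toLinearMap ∘ₗ U.toLinearMap ∘ₗ D.toLinearMap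
  map_action a x := by
    change E.symm (U (D (a • x))) = a • E.symm (U (D x))
    rw [LinearEquiv.symm_apply_eq, hE.map_smul, hD.map_smul, U.apply_smul, E.apply_symm_apply]
  inner_map x y := by
    change inner C(C, ℂ) (E.symm (U (D x))) (E.symm (U (D y))) = inner C(C, ℂ) x y
    rw [← hE.transfer_inner, E.apply_symm_apply, E.apply_symm_apply, U.inner_apply_apply,
      hD.transfer_inner]

theorem apply_conj (hD : S.IsDilation D) (hE : S.IsDilation E) (U : IPMap Y W) (x : X.carrier) :
    E (hD.conj hE U x) = U (D x) :=
  E.apply_symm_apply _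

end IsDilation

theorem tensor_map_ext {f g : IPMap (S.tensor X) Y}
    (h : ∀ x m, f (S.tmul X x m) = g (S.tmul X x m)) (z : (S.tensor X).carrier) : f z = g z := by
  have hfg : f.toLinearMap ∘ₗ (S.preTensor X).toCompletion =
      g.toLinearMap ∘ₗ (S.preTensor X).toCompletion :=
    TensorProduct.ext' (R := ℂ) (M := X.carrier) (N := S.ML.carrier) h
  exact PreHilbertModule.completion_map_ext (LinearMap.congr_fun hfg) z

variable (X) in
theorem surjective_tensorTwist : Function.Surjective (S.tensorTwist X) := by
  intro x
  have h : (1 : C(C, ℂ)) • (S.tw 1 X).symm x = (S.tw 1 X).symm x :=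
    X.ext_inner fun z => by rw [CStarModule.inner_op_smul_right, one_mul]
  refine ⟨S.tmul X ((S.tw 1 X).symm x) (S.ofFun 1), ?_⟩
  rw [tensorTwist_tmul, LinearEquiv.symm_apply_apply, h, LinearEquiv.apply_symm_apply]

variable (X) in
/-- The identification `x ⊗ f ↦ x · f` of `X ⊗ M_L` with `X_L`, regarded as a dilation of
`X ⊗ M_L` onto `X`. -/
def tensorDilation : (S.tensor X).carrier ≃ₗ[ℂ] X.carrier :=
  LinearEquiv.ofBijective (S.tensorTwist X).toLinearMap
    ⟨(S.tensorTwist X).isometry.injective, S.surjective_tensorTwist X⟩ ≪≫ₗ (S.tw 1 X).symm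

theorem tensorDilation_apply (z : (S.tensor X).carrier) :
    S.tensorDilation X z = (S.tw 1 X).symm (S.tensorTwist X z) := rfl

theorem tensorDilation_tmul (x : X.carrier) (m : S.ML.carrier) :
    S.tensorDilation X (S.tmul X x m) = S.ofFun.symm m • x := by
  rw [tensorDilation_apply, tensorTwist_tmul, LinearEquiv.symm_apply_apply]

variable (X) in
theorem isDilation_tensorDilation : S.IsDilation (S.tensorDilation X) where
  map_smul f z := congrArg (S.tw 1 X).symm ((S.tensorTwist X).apply_smul f z)
  transfer_inner z z' := (S.tensorTwist X).inner_apply_apply z z'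

theorem tensorDilation_tensorMap (U : IPMap X Y) (z : (S.tensor X).carrier) :
    S.tensorDilation Y (S.tensorMap U z) = U (S.tensorDilation X z) := by
  let U' : IPMap (S.tensor X) (S.tensor Y) :=
    (S.isDilation_tensorDilation X).conj (S.isDilation_tensorDilation Y) U
  have hU' (z) : S.tensorDilation Y (U' z) = U (S.tensorDilation X z) :=
    IsDilation.apply_conj _ _ U z
  rw [← hU', S.tensor_map_ext (f := S.tensorMap U) (g := U') fun x m => ?_]
  apply (S.tensorDilation Y).injective
  rw [hU', tensorMap_tmul, tensorDilation_tmul, tensorDilation_tmul, U.apply_smul]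

namespace IsDilation

variable {S} {D : X.carrier ≃ₗ[ℂ] Y.carrier}

/-- A dilation `D : X → Y`, regarded as a map `X → Y ⊗ M_L`. -/
def toTensor (hD : S.IsDilation D) : IPMap X (S.tensor Y) :=
  hD.conj (S.isDilation_tensorDilation Y) (IPMap.id Y)

theorem tensorDilation_toTensor (hD : S.IsDilation D) (x : X.carrier) :
    S.tensorDilation Y (hD.toTensor x) = D x :=
  hD.apply_conj _ _ x

theorem tensorTwist_toTensor (hD : S.IsDilation D) (x : X.carrier) :
    S.tensorTwist Y (hD.toTensor x) = S.tw 1 Y (D x) :=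
  (S.tw 1 Y).symm.injective (hD.tensorDilation_toTensor x)

theorem isScalingFunction_toTensor {D : X.carrier ≃ₗ[ℂ] X.carrier} (hD : S.IsDilation D)
    {φ : X.carrier} (hφ : inner C(C, ℂ) φ φ = (1 : C(C, ℂ))) {m : S.ML.carrier}
    (hDφ : D φ = S.ofFun.symm m • φ) : S.IsScalingFunction m X hD.toTensor φ where
  surjective z := ⟨D.symm (S.tensorDilation X z), (S.tensorDilation X).injective <| by
    rw [hD.tensorDilation_toTensor, D.apply_symm_apply]⟩
  inner_self := hφ
  map_eq := (S.tensorDilation X).injective <| by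
    rw [hD.tensorDilation_toTensor, hDφ, S.tensorDilation_tmul]

end IsDilation

end Dilation

section Tower

open HilbertModule

variable {X : ℕ → HilbertModule.{u} C} {T : ∀ k, IPMap (X k) (X (k + 1))}
  {δ : ∀ k, (X (k + 1)).carrier ≃ₗ[ℂ] (X k).carrier}

variable (T δ) in
/-- A dilation tower is a sequence `T k : X k → X (k + 1)` whose shift is its image under
`Y ↦ Y_L`: the modules are identified by dilations `δ k : X (k + 1) → X k`, which intertwine the
maps `T k`. -/
structure IsDilationTower : Prop where
  isDilation (k : ℕ) : S.IsDilation (δ k)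
  map_dilation (k : ℕ) (x : (X (k + 1)).carrier) : T k (δ k x) = δ (k + 1) (T (k + 1) x)

namespace IsDilationTower

variable {S} (h : S.IsDilationTower T δ)
include h

theorem isAdjointable (hT : (T 0).IsAdjointable) (k : ℕ) : (T k).IsAdjointable := by
  induction k with
  | zero => exact hT
  | succ k ih =>
    obtain ⟨T', hT'⟩ := ih
    refine ⟨fun y => (δ k).symm (T' (δ (k + 1) y)), fun x y => ?_⟩
    rw [← (h.isDilation (k + 1)).transfer_inner, ← h.map_dilation, hT',
      ← (h.isDilation k).transfer_inner x, (δ k).apply_symm_apply]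

/-- The map `R : X_∞ → X_∞ ⊗ M_L` with `R ι^{k+1} = ι^k ⊗ id`, where `X (k + 1)` is identified with
`X k ⊗ M_L` by `δ k`. -/
def limitTensor : IPMap (limit T) (S.tensor (limit T)) :=
  limitLift
    (fun k => ((h.isDilation k).conj (S.isDilation_tensorDilation _) (toLimit T k)).comp (T k))
    fun k x => (S.tensorDilation _).injective <| by
      rw [IPMap.comp_apply, IPMap.comp_apply, IsDilation.apply_conj, IsDilation.apply_conj,
        ← h.map_dilation, toLimit_succ]

theorem tensorDilation_limitTensor (k : ℕ) (x : (X (k + 1)).carrier) :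
    S.tensorDilation _ (h.limitTensor (toLimit T (k + 1) x)) = toLimit T k (δ k x) := by
  rw [limitTensor, limitLift_toLimit, IPMap.comp_apply, IsDilation.apply_conj, ← h.map_dilation,
    toLimit_succ]

theorem limitTensor_toLimit_succ (k : ℕ) (z : (S.tensor (X k)).carrier) :
    h.limitTensor (toLimit T (k + 1) ((δ k).symm (S.tensorDilation _ z))) =
      S.tensorMap (toLimit T k) z := by
  apply (S.tensorDilation _).injective
  rw [h.tensorDilation_limitTensor, (δ k).apply_symm_apply, S.tensorDilation_tensorMap]

theorem surjective_limitTensor : Function.Surjective h.limitTensor := by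
  refine h.limitTensor.surjective_of_denseRange (Dense.mono ?_
    ((S.tensorDilation _).symm.surjective.denseRange.dense_image
      (S.isDilation_tensorDilation _).continuous_symm (dense_iUnion_range_toLimit T)))
  rintro _ ⟨y, hy, rfl⟩
  obtain ⟨k, x, rfl⟩ := Set.mem_iUnion.mp hy
  refine ⟨toLimit T (k + 1) ((δ k).symm x), (S.tensorDilation _).injective ?_⟩
  rw [h.tensorDilation_limitTensor, LinearEquiv.apply_symm_apply, LinearEquiv.apply_symm_apply]

variable {Z : HilbertModule.{v} C} {D : Z.carrier ≃ₗ[ℂ] Z.carrier}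

theorem dilation_toLimit_succ {Q : IPMap (limit T) Z}
    (hDQ : ∀ z, D (Q z) = Q (S.tensorDilation _ (h.limitTensor z))) (k : ℕ)
    (x : (X (k + 1)).carrier) : D (Q (toLimit T (k + 1) x)) = Q (toLimit T k (δ k x)) :=
  (hDQ _).trans (congrArg Q (h.tensorDilation_limitTensor k x))

theorem range_toLimit_succ_eq_preimage {Q : IPMap (limit T) Z}
    (hDQ : ∀ z, D (Q z) = Q (S.tensorDilation _ (h.limitTensor z))) (k : ℕ) :
    Set.range (Q.comp (toLimit T (k + 1))) = D ⁻¹' Set.range (Q.comp (toLimit T k)) := by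
  ext z
  constructor
  · rintro ⟨x, rfl⟩
    exact ⟨δ k x, (h.dilation_toLimit_succ hDQ k x).symm⟩
  · rintro ⟨x, hx⟩
    refine ⟨(δ k).symm x, D.injective ((h.dilation_toLimit_succ hDQ k _).trans ?_)⟩
    rw [(δ k).apply_symm_apply]
    exact hx

theorem isProjectiveMRA (hT : (T 0).IsAdjointable) {Q : IPMap (limit T) Z}
    (hDQ : ∀ z, D (Q z) = Q (S.tensorDilation _ (h.limitTensor z))) :
    IsProjectiveMRA D (LinearMap.range Q.toLinearMap)
      fun k => LinearMap.range (Q.toLinearMap ∘ₗ (toLimit T k).toLinearMap) := by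
  have hcomp (k : ℕ) := isComplementedIn_range_comp_toLimit_succ (h.isAdjointable hT k) Q
  have hle (k : ℕ) : LinearMap.range (Q.comp (toLimit T k)).toLinearMap ≤
      LinearMap.range Q.toLinearMap := LinearMap.range_comp_le_range _ _
  have hdense := range_subset_closure_iUnion_range Q
  refine ⟨isComplementedIn_of_dense Q.isClosedSubmodule_range hcomp hle hdense, fun k => ?_,
    hcomp, hle, hdense⟩
  induction k with
  | zero => rfl
  | succ k ih => exact (h.range_toLimit_succ_eq_preimage hDQ k).trans (congrArg (D ⁻¹' ·) ih)

variable (hD : S.IsDilation D) (Q₀ : IPMap (X 0) Z)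

/-- The maps `D^{-k} Q₀ δ_0 ⋯ δ_{k-1} : X k → Z`. -/
def dilationMap : ∀ k, IPMap (X k) Z
  | 0 => Q₀
  | k + 1 => (h.isDilation k).conj hD (dilationMap k)

theorem dilation_dilationMap (k : ℕ) (x : (X (k + 1)).carrier) :
    D (h.dilationMap hD Q₀ (k + 1) x) = h.dilationMap hD Q₀ k (δ k x) :=
  (h.isDilation k).apply_conj hD _ x

variable {Q₀} (hQ₀ : ∀ x, D (Q₀ x) = Q₀ (δ 0 (T 0 x)))
include hQ₀

theorem dilationMap_succ_map (k : ℕ) (x : (X k).carrier) :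
    h.dilationMap hD Q₀ (k + 1) (T k x) = h.dilationMap hD Q₀ k x := by
  apply D.injective
  induction k with
  | zero => rw [h.dilation_dilationMap]; exact (hQ₀ x).symm
  | succ k ih =>
    rw [h.dilation_dilationMap, h.dilation_dilationMap, ← h.map_dilation, D.injective (ih _)]

/-- The map `Q : X_∞ → Z` with `Q ι^0 = Q₀` and `D Q = Q R`. -/
def limitMap : IPMap (limit T) Z :=
  limitLift (h.dilationMap hD Q₀) (h.dilationMap_succ_map hD hQ₀)

theorem limitMap_toLimit_zero (x : (X 0).carrier) :
    h.limitMap hD hQ₀ (toLimit T 0 x) = Q₀ x :=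
  limitLift_toLimit _ _ 0 x

theorem dilation_limitMap (z : (limit T).carrier) :
    D (h.limitMap hD hQ₀ z) = h.limitMap hD hQ₀ (S.tensorDilation _ (h.limitTensor z)) := by
  let Q := h.limitMap hD hQ₀
  let Q' := ((S.isDilation_tensorDilation _).conj hD Q).comp h.limitTensor
  have hQ (k x) : Q (toLimit T k x) = h.dilationMap hD Q₀ k x := limitLift_toLimit _ _ k x
  have hQ' (z) : D (Q' z) = Q (S.tensorDilation _ (h.limitTensor z)) :=
    (S.isDilation_tensorDilation _).apply_conj hD Q _
  have hQQ' : Q z = Q' z := by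
    refine limit_map_ext T (fun k x => D.injective ?_) z
    rw [hQ', ← toLimit_succ, h.tensorDilation_limitTensor, hQ, hQ, h.dilation_dilationMap]
  exact (congrArg D hQQ').trans (hQ' z)

end IsDilationTower

end Tower

section TwistTower

variable (Y : HilbertModule.{u} C)

/-- The identity map from `Y_{L^{k+1}}` to `Y_{L^k}`, a dilation since
`Y_{L^{k+1}} = (Y_{L^k})_L`. -/
def twistDilation (k : ℕ) : (S.twist (k + 1) Y).carrier ≃ₗ[ℂ] (S.twist k Y).carrier :=
  (S.tw (k + 1) Y).symm ≪≫ₗ S.tw k Y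

theorem isDilation_twistDilation (k : ℕ) : S.IsDilation (S.twistDilation Y k) where
  map_smul f y := (S.tw k Y).symm.injective <| by
    change (S.endo ^ (k + 1)) f • (S.tw (k + 1) Y).symm y =
      (S.endo ^ k) (S.endo f) • (S.tw (k + 1) Y).symm y
    rw [pow_succ]
    rfl
  transfer_inner x y := by
    rw [inner_tw S k, inner_tw S (k + 1), pow_succ']
    rfl

/-- The identity map from `Y_{L^0}` to `Y`. -/
def twistZero : IPMap (S.twist 0 Y) Y where
  toLinearMap := (S.tw 0 Y).symm.toLinearMap
  map_action _ _ := rfl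
  inner_map _ _ := rfl

variable {Y} (T : IPMap Y (S.twist 1 Y))

/-- A map `T : Y → Y_L`, regarded as a map `Y_{L^k} → Y_{L^{k+1}}`. -/
def twistStep : ∀ k, IPMap (S.twist k Y) (S.twist (k + 1) Y)
  | 0 => T.comp (S.twistZero Y)
  | k + 1 => (S.isDilation_twistDilation Y k).conj (S.isDilation_twistDilation Y (k + 1))
      (twistStep k)

theorem isDilationTower_twistStep : S.IsDilationTower (S.twistStep T) (S.twistDilation Y) where
  isDilation := S.isDilation_twistDilation Y
  map_dilation k y := (IsDilation.apply_conj _ _ (S.twistStep T k) y).symm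

theorem twistStep_tw (k : ℕ) (y : Y.carrier) :
    S.twistStep T k (S.tw k Y y) = S.tw (k + 1) Y ((S.tw 1 Y).symm (T y)) := by
  induction k with
  | zero => rfl
  | succ k ih =>
    apply (S.twistDilation Y (k + 1)).injective
    rw [← (S.isDilationTower_twistStep T).map_dilation]
    exact ih

variable {T}

theorem isAdjointable_twistStep (hT : T.IsAdjointable) : ∀ k, (S.twistStep T k).IsAdjointable := by
  obtain ⟨T', hT'⟩ := hT
  exact (S.isDilationTower_twistStep T).isAdjointable ⟨fun y => S.tw 0 Y (T' y), fun x y => hT' _ y⟩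

end TwistTower

end ExelSystem

/-- The map `a ↦ φ · a` from `A` to a Hilbert `A`-module, for a unit vector `φ`. -/
def HilbertModule.orbitMap {C : Type w} [TopologicalSpace C] [CompactSpace C]
    {X : HilbertModule.{v} C} {φ : X.carrier} (hφ : inner C(C, ℂ) φ φ = (1 : C(C, ℂ))) :
    IPMap (HilbertModule.self C) X where
  toFun a := (show C(C, ℂ) from a) • φ
  map_add' a b := X.add_action a b φ
  map_smul' t a := X.smul_action t a φ
  map_action a b := X.mul_action a b φ
  inner_map a b := by
    rw [CStarModule.inner_op_smul_right, CStarModule.inner_op_smul_left, hφ, one_mul]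
    rfl

theorem HilbertModule.orbitMap_one {C : Type w} [TopologicalSpace C] [CompactSpace C]
    {X : HilbertModule.{v} C} {φ : X.carrier} (hφ : inner C(C, ℂ) φ φ = (1 : C(C, ℂ))) :
    HilbertModule.orbitMap hφ (1 : C(C, ℂ)) = φ :=
  X.ext_inner fun _ => CStarModule.inner_op_smul_right.trans (one_mul _)

namespace ExelSystem

variable {C : Type w} [TopologicalSpace C] [CompactSpace C] [T2Space C] (S : ExelSystem C)

section FilterTower

variable {m : S.ML.carrier} (hm : S.IsFilter m)

/-- The identification of `M_L^{⊗ (k+1)}` with `M_L^{⊗ k} ⊗ M_L`, regarded as a dilation of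
`M_L^{⊗ (k+1)}` onto `M_L^{⊗ k}`. -/
def tensorPowDilation :
    ∀ k, (S.tensorPow (k + 1)).carrier ≃ₗ[ℂ] (S.tensorPow k).carrier
  | 0 => S.ofFun.symm
  | k + 1 => S.tensorDilation (S.tensorPow (k + 1))

theorem isDilation_tensorPowDilation : ∀ k, S.IsDilation (S.tensorPowDilation k)
  | 0 => ⟨fun _ _ => rfl, fun _ _ => rfl⟩
  | k + 1 => S.isDilation_tensorDilation (S.tensorPow (k + 1))

theorem isDilationTower_filterMap : S.IsDilationTower (S.filterMap hm) S.tensorPowDilation where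
  isDilation := S.isDilation_tensorPowDilation
  map_dilation
    | 0, n => (S.tensorDilation_tmul m n).symm
    | k + 1, z => (S.tensorDilation_tensorMap (S.filterMap hm (k + 1)) z).symm

theorem isAdjointable_filterMap_zero : (S.filterMap hm 0).IsAdjointable :=
  ⟨fun n => S.scalar (inner C(C, ℂ) m n), fun _ _ =>
    CStarModule.inner_op_smul_left (A := C(C, ℂ)) (E := S.ML.carrier)⟩

theorem limitTensor_leftMul (a : C(C, ℂ)) (n : S.ML.carrier) :
    (S.isDilationTower_filterMap hm).limitTensor
        (HilbertModule.toLimit (S.filterMap hm) 1 (S.leftMul a n)) =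
      S.tmul _ (HilbertModule.toLimit (S.filterMap hm) 0 (S.scalar a)) n := by
  have hmul : S.tensorDilation _ (S.tmul _ (S.scalar a) n) = a * S.ofFun.symm n :=
    (S.tensorDilation_tmul (S.scalar a) n).trans (mul_comm (S.ofFun.symm n) a)
  rw [← tensorMap_tmul, ← (S.isDilationTower_filterMap hm).limitTensor_toLimit_succ, hmul]
  rfl

theorem limitTensor_toLimit_add_two (k : ℕ) (z : (S.tensorPow (k + 2)).carrier) :
    (S.isDilationTower_filterMap hm).limitTensor
        (HilbertModule.toLimit (S.filterMap hm) (k + 2) z) =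
      S.tensorMap (HilbertModule.toLimit (S.filterMap hm) (k + 1)) z :=
  (congrArg (fun y => (S.isDilationTower_filterMap hm).limitTensor
      (HilbertModule.toLimit (S.filterMap hm) (k + 2) y))
    ((S.tensorPowDilation (k + 1)).symm_apply_apply z).symm).trans
    ((S.isDilationTower_filterMap hm).limitTensor_toLimit_succ (k + 1) z)

variable {S}

theorem IsDilation.apply_orbitMap {X : HilbertModule.{v} C} {D : X.carrier ≃ₗ[ℂ] X.carrier}
    (hD : S.IsDilation D) {φ : X.carrier} (hφ : inner C(C, ℂ) φ φ = (1 : C(C, ℂ)))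
    (hDφ : D φ = S.ofFun.symm m • φ) (a : C(C, ℂ)) :
    D (HilbertModule.orbitMap hφ a) =
      HilbertModule.orbitMap hφ (S.ofFun.symm (S.filterMap hm 0 (S.scalar a))) := by
  change D (a • φ) = (S.endo a * S.ofFun.symm m : C(C, ℂ)) • φ
  rw [hD.map_smul, hDφ, X.mul_action]

end FilterTower

end ExelSystem

end

theorem mainTheorem5 {C : Type w} [TopologicalSpace C] [CompactSpace C] [T2Space C]
    (S : ExelSystem C) :
    -- general initial module `Y`
    (∀ (Y : HilbertModule.{u} C) (T : IPMap Y (S.twist 1 Y)), T.IsAdjointable →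
      ∃ Tk : ∀ k, IPMap (S.twist k Y) (S.twist (k + 1) Y),
        (∀ k y, Tk k (S.tw k Y y) = S.tw (k + 1) Y ((S.tw 1 Y).symm (T y))) ∧
        (∀ k, (Tk k).IsAdjointable) ∧
        ∃ R : IPMap (HilbertModule.limit Tk) (S.tensor (HilbertModule.limit Tk)),
          Function.Surjective R ∧
          (∀ k (z : (S.tensor (S.twist k Y)).carrier),
            R (HilbertModule.toLimit Tk (k + 1) (S.twSucc k Y (S.tensorTwist (S.twist k Y) z))) =
              S.tensorMap (HilbertModule.toLimit Tk k) z) ∧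
          ∀ (X : HilbertModule.{v} C) (D : X.carrier ≃ₗ[ℂ] X.carrier) (Q₀ : IPMap Y X),
            (∀ (f : C(C, ℂ)) (x : X.carrier), D (f • x) = S.endo f • D x) →
            (∀ x y : X.carrier, S.transfer (inner C(C, ℂ) (D x) (D y)) = inner C(C, ℂ) x y) →
            (∀ y, D (Q₀ y) = Q₀ ((S.tw 1 Y).symm (T y))) →
            ∃ Q : IPMap (HilbertModule.limit Tk) X,
              (∀ y, Q (HilbertModule.toLimit Tk 0 (S.tw 0 Y y)) = Q₀ y) ∧
              (∀ z, D (Q z) = Q ((S.tw 1 _).symm (S.tensorTwist _ (R z)))) ∧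
              HilbertModule.IsProjectiveMRA D (LinearMap.range Q.toLinearMap)
                (fun k => LinearMap.range
                  (Q.toLinearMap ∘ₗ (HilbertModule.toLimit Tk k).toLinearMap))) ∧
    -- initial module `C(C)` and a filter `m`
    (∀ (m : S.ML.carrier) (hm : S.IsFilter m),
      ∃ R : IPMap (HilbertModule.limit (S.filterMap hm))
          (S.tensor (HilbertModule.limit (S.filterMap hm))),
        Function.Surjective R ∧
        (∀ (a : C(C, ℂ)) (n : S.ML.carrier),
          R (HilbertModule.toLimit (S.filterMap hm) 1 (S.leftMul a n)) =
            S.tmul _ (HilbertModule.toLimit (S.filterMap hm) 0 (S.scalar a)) n) ∧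
        (∀ k (z : (S.tensorPow (k + 2)).carrier),
          R (HilbertModule.toLimit (S.filterMap hm) (k + 2) z) =
            S.tensorMap (HilbertModule.toLimit (S.filterMap hm) (k + 1)) z) ∧
        ∀ (X : HilbertModule.{v} C) (D : X.carrier ≃ₗ[ℂ] X.carrier) (φ : X.carrier),
          inner C(C, ℂ) φ φ = (1 : C(C, ℂ)) →
          (∀ (f : C(C, ℂ)) (x : X.carrier), D (f • x) = S.endo f • D x) →
          (∀ x y : X.carrier, S.transfer (inner C(C, ℂ) (D x) (D y)) = inner C(C, ℂ) x y) →
          D φ = S.ofFun.symm m • φ →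
          (∃ D' : IPMap X (S.tensor X), (∀ x, S.tensorTwist X (D' x) = S.tw 1 X (D x)) ∧
            S.IsScalingFunction m X D' φ) ∧
          ∃ Q : IPMap (HilbertModule.limit (S.filterMap hm)) X,
            Q (HilbertModule.toLimit (S.filterMap hm) 0 (S.scalar 1)) = φ ∧
            (∀ z, D (Q z) = Q ((S.tw 1 _).symm (S.tensorTwist _ (R z)))) ∧
            HilbertModule.IsProjectiveMRA D (LinearMap.range Q.toLinearMap)
              (fun k => LinearMap.range
                (Q.toLinearMap ∘ₗ (HilbertModule.toLimit (S.filterMap hm) k).toLinearMap))) := by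
  refine ⟨fun Y T hT => ?_, fun m hm => ?_⟩
  · have h := S.isDilationTower_twistStep T
    have hT₀ := S.isAdjointable_twistStep hT
    refine ⟨S.twistStep T, S.twistStep_tw T, hT₀, h.limitTensor, h.surjective_limitTensor,
      h.limitTensor_toLimit_succ, fun X D Q₀ hα hL hQ₀ => ?_⟩
    have hDQ₀ (y : (S.twist 0 Y).carrier) := hQ₀ ((S.tw 0 Y).symm y)
    let Q := h.limitMap (Q₀ := Q₀.comp (S.twistZero Y)) ⟨hα, hL⟩ hDQ₀
    have hDQ : ∀ z, D (Q z) = Q (S.tensorDilation _ (h.limitTensor z)) := h.dilation_limitMap _ _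
    exact ⟨Q, fun y => h.limitMap_toLimit_zero _ _ (S.tw 0 Y y), hDQ,
      h.isProjectiveMRA (hT₀ 0) hDQ⟩
  · have h := S.isDilationTower_filterMap hm
    refine ⟨h.limitTensor, h.surjective_limitTensor, S.limitTensor_leftMul hm,
      S.limitTensor_toLimit_add_two hm, fun X D φ hφ hα hL hDφ => ?_⟩
    have hD : S.IsDilation D := ⟨hα, hL⟩
    let Q := h.limitMap hD (Q₀ := HilbertModule.orbitMap hφ) (hD.apply_orbitMap hm hφ hDφ)
    have hDQ : ∀ z, D (Q z) = Q (S.tensorDilation _ (h.limitTensor z)) := h.dilation_limitMap _ _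
    exact ⟨⟨hD.toTensor, hD.tensorTwist_toTensor, hD.isScalingFunction_toTensor hφ hDφ⟩, Q,
      (h.limitMap_toLimit_zero _ _ _).trans (HilbertModule.orbitMap_one hφ), hDQ,
      h.isProjectiveMRA (S.isAdjointable_filterMap_zero hm) hDQ⟩
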